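/- Let $k$ be a commutative artinian ring and let $\Lambda\neq 0$ be an artin $k$-algebra (a $k$-algebra that is finitely generated as a $k$-module) which is a Nakayama algebra, i.e. all indecomposable projective left $\Lambda$-modules and all indecomposable projective right $\Lambda$-modules are uniserial. Let $s$ be the number of isomorphism classes of simple left $\Lambda$-modules, let $p$ be the minimal length of an indecomposable projective left $\Lambda$-module, and assume that $p>s$ (so that no simple module is projective). The resolution quiver $R(\Lambda)$ has as vertices the isomorphism classes of simple left $\Lambda$-modules, and it has an arrow $S\to\tau\operatorname{soc}P(S)$ for every vertex $S$, where $P(S)$ is the projective cover of $S$, $\operatorname{soc}$ is the socle and $\tau=D\operatorname{Tr}$ is the Auslander-Reiten translation. A vertex $S$ is called black if the projective dimension of $S$ is at least $2$, and a cycle of $R(\Lambda)$ (a loop is a cycle of length one) is called black if all its vertices are black. The algebra $\Lambda$ is called a Gorenstein algebra if the injective dimensions of ${}_\Lambda\Lambda$ and of $\Lambda_\Lambda$ are both finite; the Gorenstein dimension of $\Lambda$ is then the common value of these two dimensions. The algebra $\Lambda$ is a Gorenstein algebra if and only if all cycles in $R(\Lambda)$ are black. In this case, the Gorenstein dimension of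 $\Lambda$ equals $2d$ (in other words, the injective dimensions of ${}_\Lambda\Lambda$ and of $\Lambda_\Lambda$ are both equal to $2d$), where $d$ is the maximum over all vertices $x$ of $R(\Lambda)$ of the distance from $x$ to the black cycles, i.e. of the minimal length of a path in $R(\Lambda)$ that starts at $x$ and ends at a vertex of a black cycle. -/

import Mathlib

open CategoryTheory MulOpposite

universe u v

namespace ArtinAlg

/-! ### Modules over a ring -/

section Modules

variable (R : Type u) [Ring R]

/-- A module is uniserial if its submodules form a chain. -/
def IsUniserial (M : Type*) [AddCommGroup M] [Module R M] : Prop :=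
  ∀ N N' : Submodule R M, N ≤ N' ∨ N' ≤ N

/-- A module is indecomposable if it is nonzero and is not the direct sum of two nonzero
submodules. -/
def IsIndecomposable (M : Type*) [AddCommGroup M] [Module R M] : Prop :=
  Nontrivial M ∧ ∀ N N' : Submodule R M, IsCompl N N' → N = ⊥ ∨ N' = ⊥

/-- The socle: the sum of all simple submodules. -/
def socle (M : Type*) [AddCommGroup M] [Module R M] : Submodule R M :=
  sSup {N : Submodule R M | IsSimpleModule R N}

/-- `π : P → M` is a projective cover: `P` is projective, `π` is surjective and the kernel of `π`
is a superfluous submodule. -/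
def IsProjectiveCover {P M : Type*} [AddCommGroup P] [Module R P] [AddCommGroup M] [Module R M]
    (π : P →ₗ[R] M) : Prop :=
  Module.Projective R P ∧ Function.Surjective π ∧
    ∀ N : Submodule R P, N ⊔ LinearMap.ker π = ⊤ → N = ⊤

/-- `ι : M → E` is an injective hull: `E` is injective, `ι` is injective and its image is an
essential submodule. -/
def IsInjectiveHull {M : Type*} {E : Type u} [AddCommGroup M] [Module R M]
    [AddCommGroup E] [Module R E] (ι : M →ₗ[R] E) : Prop :=
  Module.Injective R E ∧ Function.Injective ι ∧
    ∀ N : Submodule R E, N ⊓ LinearMap.range ι = ⊥ → N = ⊥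

/-- All finitely generated indecomposable projective left `R`-modules are uniserial. -/
def ProjectivesUniserial : Prop :=
  ∀ (P : Type u) [AddCommGroup P] [Module R P],
    Module.Finite R P → Module.Projective R P → IsIndecomposable R P → IsUniserial R P

/-- The minimal length of a finitely generated indecomposable projective left `R`-module. -/
noncomputable def minProjectiveLength : ℕ∞ :=
  sInf {n : ℕ∞ | ∃ P : ModuleCat.{u} R, Module.Finite R P ∧ Module.Projective R P ∧
    IsIndecomposable R P ∧ n = Module.length R P}

end Modules

/-! ### Nakayama algebras and Gorenstein algebras -/

section Algebras

variable (Λ : Type u) [Ring Λ]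

/-- The condition for an artin algebra to be a Nakayama algebra: the indecomposable projective
left modules and the indecomposable projective right modules are uniserial. Right `Λ`-modules are
left modules over the opposite ring. -/
def IsNakayama : Prop :=
  ProjectivesUniserial Λ ∧ ProjectivesUniserial Λᵐᵒᵖ

/-- The injective dimension of `Λ` as a left module over itself. -/
noncomputable def leftInjDim : WithBot ℕ∞ :=
  injectiveDimension (ModuleCat.of Λ Λ)

/-- The injective dimension of `Λ` as a right module over itself. -/
noncomputable def rightInjDim : WithBot ℕ∞ :=
  injectiveDimension (ModuleCat.of Λᵐᵒᵖ Λ)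

/-- The condition for an artin algebra to be a Gorenstein algebra: its injective dimension is
finite on both sides. -/
def IsGorenstein : Prop :=
  leftInjDim Λ < ⊤ ∧ rightInjDim Λ < ⊤

/-- `v` is the Gorenstein dimension: the common value of the two self-injective dimensions. -/
def IsGorensteinDimension (v : ℕ) : Prop :=
  leftInjDim Λ = (v : WithBot ℕ∞) ∧ rightInjDim Λ = (v : WithBot ℕ∞)

end Algebras

/-! ### Simple modules up to isomorphism -/

section Simples

variable (Λ : Type u) [Ring Λ]

/-- The simple left `Λ`-modules. -/
abbrev SimpleMod : Type (u + 1) :=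
  {S : ModuleCat.{u} Λ // IsSimpleModule Λ S}

/-- Isomorphism of simple modules. -/
def simpleSetoid : Setoid (SimpleMod Λ) where
  r S T := Nonempty (S.1 ≃ₗ[Λ] T.1)
  iseqv :=
    { refl := fun S => ⟨LinearEquiv.refl Λ S.1⟩
      symm := fun ⟨e⟩ => ⟨e.symm⟩
      trans := fun ⟨e⟩ ⟨f⟩ => ⟨e.trans f⟩ }

/-- The isomorphism classes of simple left `Λ`-modules. -/
def SimpleClass : Type (u + 1) :=
  Quotient (simpleSetoid Λ)

variable {Λ}

/-- The isomorphism class of a simple module. -/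
def SimpleMod.toClass (S : SimpleMod Λ) : SimpleClass Λ :=
  Quotient.mk (simpleSetoid Λ) S

/-- An isomorphism class of simple modules is black if the projective dimension of its members is
at least two. -/
def IsBlack (x : SimpleClass Λ) : Prop :=
  ∃ S : SimpleMod Λ, S.toClass = x ∧ 2 ≤ projectiveDimension S.1

end Simples

/-! ### The Auslander-Reiten translation `D Tr` -/

section Translate

variable (k : Type v) [CommRing k] {Λ : Type u} [Ring Λ] [Algebra k Λ]

/-- The transpose determined by a presentation `f : P₁ → P₀`: the cokernel of
`Hom(f, Λ) : Hom(P₀, Λ) → Hom(P₁, Λ)`, a right `Λ`-module. -/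
abbrev Transpose {P₀ P₁ : Type u} [AddCommGroup P₀] [Module Λ P₀] [AddCommGroup P₁] [Module Λ P₁]
    (f : P₁ →ₗ[Λ] P₀) : Type u :=
  (P₁ →ₗ[Λ] Λ) ⧸ LinearMap.range (LinearMap.lcomp Λᵐᵒᵖ Λ f)

/-- The left module `N` is isomorphic to the dual `Hom_k(X, J)` of the right module `X`, where
`(a • φ) x = φ (x a)` for `a ∈ Λ`. -/
def IsDual (J : Type v) [AddCommGroup J] [Module k J]
    (N : Type u) [AddCommGroup N] [Module Λ N]
    (X : Type u) [AddCommGroup X] [Module Λᵐᵒᵖ X] [Module k X] : Prop :=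
  ∃ e : N ≃+ (X →ₗ[k] J), ∀ (a : Λ) (n : N) (x : X), e (a • n) x = e n (op a • x)

/-- The finitely generated left module `N` is isomorphic to the Auslander-Reiten translate
`D Tr M` of `M`, where `D = Hom_k(-, J)` and `Tr M` is computed from a minimal projective
presentation `P₁ → P₀ → M → 0`. -/
def IsARTranslate (J : Type v) [AddCommGroup J] [Module k J]
    (M N : Type u) [AddCommGroup M] [Module Λ M] [AddCommGroup N] [Module Λ N] : Prop :=
  ∃ (P₀ P₁ : ModuleCat.{u} Λ) (f : P₁ →ₗ[Λ] P₀) (π : P₀ →ₗ[Λ] M),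
    IsProjectiveCover Λ π ∧ LinearMap.range f = LinearMap.ker π ∧
    IsProjectiveCover Λ f.rangeRestrict ∧ IsDual (Λ := Λ) k J N (Transpose f)

end Translate

/-! ### The resolution quiver -/

section ResolutionQuiver

variable (k : Type v) [CommRing k] {Λ : Type u} [Ring Λ] [Algebra k Λ]
  (J : Type v) [AddCommGroup J] [Module k J]

/-- The arrows `S → τ soc P(S)` of the resolution quiver, whose vertices are the isomorphism
classes of simple modules; `P(S)` is a projective cover of `S`. -/
def Arrow (x y : SimpleClass Λ) : Prop :=
  ∃ (S T : SimpleMod Λ) (P : ModuleCat.{u} Λ) (π : P →ₗ[Λ] S.1),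
    S.toClass = x ∧ T.toClass = y ∧ IsProjectiveCover Λ π ∧
    IsARTranslate (Λ := Λ) k J (socle Λ P) T.1

/-- A cycle of length `n + 1` in the resolution quiver: pairwise different vertices
`c 0 → c 1 → ⋯ → c n → c 0`. A loop is a cycle of length one. -/
def IsCycle (n : ℕ) (c : ZMod (n + 1) → SimpleClass Λ) : Prop :=
  Function.Injective c ∧ ∀ i, Arrow k J (c i) (c (i + 1))

/-- All vertices of all cycles of the resolution quiver of `Λ` are black. -/
def AllCyclesBlack (Λ : Type u) [Ring Λ] [Algebra k Λ] : Prop :=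
  ∀ (n : ℕ) (c : ZMod (n + 1) → SimpleClass Λ), IsCycle k J n c → ∀ i, IsBlack (c i)

/-- A vertex is cyclically black if it lies on a black cycle, that is, on a cycle all of whose
vertices are black. -/
def IsCyclicallyBlack (x : SimpleClass Λ) : Prop :=
  ∃ (n : ℕ) (c : ZMod (n + 1) → SimpleClass Λ),
    IsCycle k J n c ∧ (∀ i, IsBlack (c i)) ∧ ∃ i, c i = x

/-- There is a path of length `n` from `x` to a vertex of a black cycle. -/
def HasPathToBlackCycle (x : SimpleClass Λ) (n : ℕ) : Prop :=
  ∃ c : ℕ → SimpleClass Λ, c 0 = x ∧ (∀ i < n, Arrow k J (c i) (c (i + 1))) ∧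
    IsCyclicallyBlack k J (c n)

/-- The distance from a vertex to the black cycles: the minimal length of a path to a vertex of a
black cycle (infinite if there is no such path). -/
noncomputable def distToBlack (x : SimpleClass Λ) : ℕ∞ :=
  sInf {m : ℕ∞ | ∃ n : ℕ, m = n ∧ HasPathToBlackCycle k J x n}

end ResolutionQuiver

end ArtinAlg

universe w

namespace ArtinAlg

/-! The algebra is replaced by combinatorial data, a `NakayamaSystem`. Each simple class `x` gets an
idempotent `e x` with `P(x) = Λ e x`; the radical of `P(x)` is generated by an arrow `α x`, and
sending `x` to the top `σ x` of that radical is a permutation of the simples. A uniserial module is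
coded by its top `x` and its length `l` (`IsGenerator`), and its syzygy has top `σ^l x` and length
`len x - l`. Hence the second syzygy has top `next x = σ^(len x) x`, whatever `l` is. Since `τ`
moves a simple by `σ` and `soc P(x)` sits at `σ^(len x - 1) x`, the resolution quiver is the graph
of the function `next` (`HasTops.arrow_iff`). A vertex is black exactly when `len x ≤ len (σ x)`,
that is, when `rad P(x)` is not projective.

The group `Ext¹(M, Λ)` vanishes if the top `x` of `M` is black. It is nonzero if `x` is not black
and `0 < l < len x`. Shifting dimensions, odd Ext groups test the blackness of iterates of `next`.
For the converse one needs modules all of whose syzygies stay strictly between zero and projective: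
take `l = t` with `σ^t x = x`. Then the syzygy lengths alternate between `t` and `len - t`, and the
bound `p > s` ensures `t < len y` for all `y`. So the injective dimension is at most `n` if and only
if all `next^[n / 2] x` are black (`hasInjectiveDimensionLE_iff`).

The map `next` is injective on black vertices. Therefore all `next^[m] x` are black if and only if
all periodic vertices are black and every vertex is periodic after `m` steps (`forall_black_iff`).
Periodic vertices are the vertices on cycles, so the least such `m` is the maximal distance `d`, and
the dimension is `2d`.

For the right module the same criterion is applied to the opposite system. Lifted to `ℤ`, the two
successor maps form a Galois connection, which carries the blackness condition over
(`opp_black_iff`). -/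

/-- The product of `n` successive arrows, the first one starting at `x`. -/
def arrowPath {R : Type u} {V : Type w} [Ring R] (e α : V → R) (σ : Equiv.Perm V) : ℕ → V → R
  | 0, x => e x
  | n + 1, x => arrowPath e α σ n (σ x) * α x

/-- Idempotents and arrows which describe a Nakayama ring without simple projective modules:
the arrow `α x` generates the radical of the left ideal generated by `e x`, and the radical of the
right ideal generated by `e (σ x)`. -/
structure NakayamaSystem (R : Type u) [Ring R] (V : Type w) where
  /-- the idempotents -/
  e : V → R
  /-- the arrows -/
  α : V → R
  /-- the end point of the arrow starting at a given vertex -/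
  σ : Equiv.Perm V
  idem : ∀ x, e x * e x = e x
  e_ne_zero : ∀ x, e x ≠ 0
  e_mul_α : ∀ x, e (σ x) * α x = α x
  α_mul_e : ∀ x, α x * e x = α x
  unit_or_arrow : ∀ x y a, e y * a = a → a * e x = a →
    (x = y ∧ ∃ b, b * a = e x ∧ a * b = e y) ∨
      ((∃ r, a = r * α x) ∧ ∃ r, a = α (σ.symm y) * r)
  nilpotent : ∀ x t, IsNilpotent (t * α x)
  exists_path_eq_zero : ∃ n, ∀ x, arrowPath e α σ n x = 0
  generate : (1 : R) ∈ AddSubgroup.closure {a | ∃ x r r', a = r * e x * r'}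

/-- There is one idempotent per class of simples, so the `e x` need not sum to `1`, nor are they
assumed orthogonal. Homogeneous elements still suffice for testing membership, because the two-sided
ideal generated by the `e x` is everything. -/
lemma mem_of_forall_idempotent_smul_mem {R : Type u} {V : Type w} [Ring R] {e : V → R}
    (he : (1 : R) ∈ AddSubgroup.closure {a | ∃ x r r', a = r * e x * r'})
    {M : Type*} [AddCommGroup M] [Module R M] {N : Submodule R M} {m : M}
    (h : ∀ (x : V) (r : R), e x • r • m ∈ N) : m ∈ N := by
  have key : ∀ a ∈ AddSubgroup.closure {a | ∃ x r r', a = r * e x * r'}, a • m ∈ N := by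
    intro a ha
    induction ha using AddSubgroup.closure_induction with
    | mem a ha =>
      obtain ⟨x, r, r', rfl⟩ := ha
      rw [mul_assoc, mul_smul, mul_smul]
      exact N.smul_mem _ (h x r')
    | zero => simp
    | add a b _ _ ha hb => rw [add_smul]; exact N.add_mem ha hb
    | neg a _ ha => rw [neg_smul]; exact N.neg_mem ha
  simpa using key 1 he

/-! ### Paths, lengths and the opposite system. -/

namespace NakayamaSystem

variable {R : Type u} [Ring R] {V : Type w} (D : NakayamaSystem R V)

/-- The product of `n` successive arrows, the first one starting at `x`. -/
def path (n : ℕ) (x : V) : R := arrowPath D.e D.α D.σ n x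

@[simp] lemma path_zero (x : V) : D.path 0 x = D.e x := rfl

lemma path_succ (n : ℕ) (x : V) : D.path (n + 1) x = D.path n (D.σ x) * D.α x := rfl

lemma path_one (x : V) : D.path 1 x = D.α x := by
  rw [path_succ, path_zero, e_mul_α]

lemma path_mul_e (n : ℕ) (x : V) : D.path n x * D.e x = D.path n x := by
  cases n with
  | zero => exact D.idem x
  | succ n => rw [path_succ, mul_assoc, α_mul_e]

lemma path_add (m n : ℕ) (x : V) : D.path (m + n) x = D.path m ((D.σ ^ n) x) * D.path n x := by
  induction n generalizing x with
  | zero => simp [path_mul_e]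
  | succ n ih => rw [← add_assoc, path_succ, path_succ, ih, mul_assoc]; rfl

lemma path_succ_eq (n : ℕ) (x : V) : D.path (n + 1) x = D.α ((D.σ ^ n) x) * D.path n x := by
  rw [add_comm, path_add, path_one]

lemma e_mul_path (n : ℕ) (x : V) : D.e ((D.σ ^ n) x) * D.path n x = D.path n x := by
  have := D.path_add 0 n x
  rwa [zero_add, path_zero, eq_comm] at this

lemma exists_path_eq (x : V) : ∃ n, D.path n x = 0 :=
  D.exists_path_eq_zero.imp fun _ h => h x

open Classical in
/-- The length of the left ideal generated by `e x`. -/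
noncomputable def len (x : V) : ℕ := Nat.find (D.exists_path_eq x)

lemma path_eq_zero_iff {n : ℕ} {x : V} : D.path n x = 0 ↔ D.len x ≤ n := by
  classical
  refine ⟨fun h => Nat.find_min' _ h, fun h => ?_⟩
  obtain ⟨k, rfl⟩ := Nat.exists_eq_add_of_le' h
  rw [add_comm, add_comm (D.len x), path_add,
    show D.path (D.len x) x = 0 from Nat.find_spec (D.exists_path_eq x), mul_zero]

lemma path_len (x : V) : D.path (D.len x) x = 0 := D.path_eq_zero_iff.2 le_rfl

lemma len_pos (x : V) : 0 < D.len x := by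
  by_contra h
  exact D.e_ne_zero x (D.path_eq_zero_iff (n := 0).2 (by omega))

/-- The `n`-th radical of `P(x)` is a quotient of `P(σ^n x)`. For `n = 1` this is the Kupisch
inequality. -/
lemma len_le_len_add (n : ℕ) (x : V) : D.len x ≤ D.len ((D.σ ^ n) x) + n := by
  rw [← path_eq_zero_iff, path_add, path_len, zero_mul]

/-- The successor map `x ↦ τ soc P(x)` of the resolution quiver. -/
noncomputable def next (x : V) : V := (D.σ ^ D.len x) x

/-- The radical of `P(x)` is not projective. -/
def Black (x : V) : Prop := D.len x ≤ D.len (D.σ x)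

lemma closure_op {S : Set R} {a : R} (h : a ∈ AddSubgroup.closure S) :
    op a ∈ AddSubgroup.closure (op '' S) := by
  have := AddSubgroup.mem_map_of_mem (opAddEquiv : R ≃+ Rᵐᵒᵖ).toAddMonoidHom h
  rwa [AddMonoidHom.map_closure] at this

lemma arrowPath_op (n : ℕ) (x : V) :
    arrowPath (fun x => op (D.e x)) (fun x => op (D.α (D.σ.symm x))) D.σ.symm n x =
      op (D.path n ((D.σ.symm ^ n) x)) := by
  induction n generalizing x with
  | zero => rfl
  | succ n ih =>
    rw [arrowPath, ih, ← op_mul, path_succ_eq, pow_succ, Equiv.Perm.mul_apply]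
    congr 3
    rw [← Equiv.Perm.mul_apply, ← Equiv.Perm.inv_def, inv_pow, mul_inv_cancel]
    rfl

/-- The opposite system. -/
def opp : NakayamaSystem Rᵐᵒᵖ V where
  e x := op (D.e x)
  α x := op (D.α (D.σ.symm x))
  σ := D.σ.symm
  idem x := by rw [← op_mul, idem]
  e_ne_zero x := by simpa using D.e_ne_zero x
  e_mul_α x := by rw [← op_mul, α_mul_e]
  α_mul_e x := by
    have := D.e_mul_α (D.σ.symm x)
    rw [Equiv.apply_symm_apply] at this
    rw [← op_mul, this]
  unit_or_arrow x y a h1 h2 := by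
    induction a using MulOpposite.rec' with | _ a
    rw [← op_mul, op_inj] at h1 h2
    rcases D.unit_or_arrow y x a h2 h1 with ⟨rfl, b, hb, hb'⟩ | ⟨⟨r, hr⟩, s, hs⟩
    · exact Or.inl ⟨rfl, op b, by rw [← op_mul, hb'], by rw [← op_mul, hb]⟩
    · refine Or.inr ⟨⟨op s, by rw [← op_mul, ← hs]⟩, op r, ?_⟩
      simp only [Equiv.symm_symm, Equiv.symm_apply_apply]
      rw [← op_mul, ← hr]
  nilpotent x t := by
    obtain ⟨n, hn⟩ := D.nilpotent (D.σ.symm x) (unop t)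
    refine ⟨n + 1, ?_⟩
    rw [← op_unop t, ← op_mul, ← op_pow, pow_succ, ← mul_assoc, mul_pow_mul, hn, mul_zero,
      zero_mul, op_zero]
  exists_path_eq_zero := by
    obtain ⟨n, hn⟩ := D.exists_path_eq_zero
    exact ⟨n, fun x => by rw [arrowPath_op]; exact congrArg op (hn _)⟩
  generate := by
    refine AddSubgroup.closure_mono ?_ (closure_op D.generate)
    rintro _ ⟨_, ⟨x, r, r', rfl⟩, rfl⟩
    exact ⟨x, op r', op r, by simp [mul_assoc]⟩

lemma opp_path (n : ℕ) (x : V) : D.opp.path n x = op (D.path n ((D.σ.symm ^ n) x)) :=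
  D.arrowPath_op n x

lemma opp_path_pow (n : ℕ) (x : V) : D.opp.path n ((D.σ ^ n) x) = op (D.path n x) := by
  rw [opp_path, ← Equiv.Perm.mul_apply, ← Equiv.Perm.inv_def, inv_pow, inv_mul_cancel]; rfl

/-- The opposite path starting at `σ^n x` is the path from `x` read backwards, so both vanish
together. This link between the two length functions later becomes a Galois connection. -/
lemma opp_len_le_iff (n : ℕ) (x : V) : D.opp.len ((D.σ ^ n) x) ≤ n ↔ D.len x ≤ n := by
  rw [← path_eq_zero_iff, ← path_eq_zero_iff, opp_path_pow, op_eq_zero_iff]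

lemma smul_mem_of_homogeneous {M : Type*} [AddCommGroup M] [Module R M] {N : Submodule R M} {m : M}
    (h : ∀ (x : V) (r : R), D.e x • r • m ∈ N) : m ∈ N :=
  mem_of_forall_idempotent_smul_mem D.generate h

lemma exists_eq_mul_of_homogeneous {b w : R} (h : ∀ x r, ∃ t, b * r * D.e x = w * t) :
    ∃ t, b = w * t := by
  have : op b ∈ Submodule.span Rᵐᵒᵖ {op w} := by
    refine D.opp.smul_mem_of_homogeneous fun x r => ?_
    obtain ⟨t, ht⟩ := h x (unop r)
    refine Submodule.mem_span_singleton.2 ⟨op t, ?_⟩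
    rw [smul_eq_mul, ← op_mul, ← ht]
    simp [opp]
  obtain ⟨t, ht⟩ := Submodule.mem_span_singleton.1 this
  exact ⟨unop t, op_injective (by rw [← ht]; simp)⟩

/-- Every element of `e y * R * e x` is a path up to an invertible factor on the left. -/
lemma exists_eq_mul_path {x y : V} {a : R} (hy : D.e y * a = a) (hx : a * D.e x = a) (ha : a ≠ 0) :
    ∃ j < D.len x, (D.σ ^ j) x = y ∧ ∃ u u', a = u * D.path j x ∧ D.path j x = u' * a := by
  -- Arrows are split off the remaining left factor one at a time, until that factor is invertible.
  -- This must happen before `len x` steps, where the path is zero.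
  have key : ∀ n, (∃ j < n, (D.σ ^ j) x = y ∧ ∃ u u', a = u * D.path j x ∧ D.path j x = u' * a) ∨
      ∃ r, a = r * D.path n x := by
    intro n
    induction n with
    | zero => exact Or.inr ⟨a, hx.symm⟩
    | succ n ih =>
      rcases ih with ⟨j, hj, h⟩ | ⟨r, hr⟩
      · exact Or.inl ⟨j, by omega, h⟩
      set z := (D.σ ^ n) x with hz
      have hr' : a = (D.e y * r * D.e z) * D.path n x := by
        rw [mul_assoc, e_mul_path, mul_assoc, ← hr, hy]
      rcases D.unit_or_arrow z y (D.e y * r * D.e z) (by simp only [← mul_assoc, D.idem])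
        (by simp only [mul_assoc, D.idem]) with ⟨h, b, hb, -⟩ | ⟨⟨s, hs⟩, -⟩
      · refine Or.inl ⟨n, by omega, h, _, b, hr', ?_⟩
        conv_rhs => rw [hr', ← mul_assoc, hb, hz, e_mul_path]
      · refine Or.inr ⟨s, ?_⟩
        rw [path_succ_eq, ← mul_assoc, ← hs, ← hr']
  rcases key (D.len x) with h | ⟨r, hr⟩
  · exact h
  · rw [path_len, mul_zero] at hr
    exact absurd hr ha

/-- Every element of `e y * R * e x` is a path up to an invertible factor on the right. -/
lemma exists_eq_path_mul {x y : V} {a : R} (hy : D.e y * a = a) (hx : a * D.e x = a) (ha : a ≠ 0) :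
    ∃ j < D.len x, (D.σ ^ j) x = y ∧ ∃ u u', a = D.path j x * u ∧ D.path j x = a * u' := by
  obtain ⟨j, hj, hjx, u, u', h1, h2⟩ := D.opp.exists_eq_mul_path (x := y) (y := x) (a := op a)
    (by simp [opp, ← op_mul, hx]) (by simp [opp, ← op_mul, hy]) (by simpa using ha)
  have hy' : (D.σ ^ j) x = y := by
    rw [← hjx, ← Equiv.Perm.mul_apply]
    change (D.σ ^ j * (D.σ⁻¹) ^ j) y = y
    rw [inv_pow, mul_inv_cancel]; rfl
  rw [← hy', opp_path_pow] at h1 h2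
  refine ⟨j, ?_, hy', unop u, unop u', ?_, ?_⟩
  · rw [← not_le, ← hy', opp_len_le_iff] at hj
    omega
  · exact op_injective (by simp [h1])
  · exact op_injective (by simp [h2])

end NakayamaSystem

/-! ### Dimension shifting and Baer's criterion in higher degrees. -/

section Shift

open Abelian

variable {R : Type u} [Ring R]

lemma subsingleton_ext_succ_iff {S : ShortComplex (ModuleCat.{u} R)} (hS : S.ShortExact)
    [Projective S.X₂] (X : ModuleCat.{u} R) (n : ℕ) :
    Subsingleton (Ext S.X₃ X (n + 2)) ↔ Subsingleton (Ext S.X₁ X (n + 1)) := by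
  constructor
  · intro h
    refine subsingleton_of_forall_eq 0 fun x => ?_
    obtain ⟨y, hy⟩ := Ext.contravariant_sequence_exact₁ hS X x (n₁ := n + 2) (by omega)
      (Subsingleton.elim _ _)
    rw [← hy, Ext.eq_zero_of_projective y, Ext.comp_zero]
  · intro h
    refine subsingleton_of_forall_eq 0 fun x => ?_
    obtain ⟨y, hy⟩ := Ext.contravariant_sequence_exact₃ hS X x (Ext.eq_zero_of_projective _)
      (n₀ := n + 1) (by omega)
    rw [← hy, Subsingleton.elim y 0, Ext.comp_zero]

lemma subsingleton_ext_one_iff {S : ShortComplex (ModuleCat.{u} R)} (hS : S.ShortExact)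
    [Projective S.X₂] (X : ModuleCat.{u} R) :
    Subsingleton (Ext S.X₃ X 1) ↔ ∀ g : S.X₁ ⟶ X, ∃ h : S.X₂ ⟶ X, S.f ≫ h = g := by
  constructor
  · intro h g
    obtain ⟨y, hy⟩ := Ext.contravariant_sequence_exact₁ hS X (Ext.mk₀ g) (n₁ := 1) (by omega)
      (Subsingleton.elim _ _)
    obtain ⟨y, rfl⟩ := Ext.addEquiv₀.symm.surjective y
    exact ⟨y, Ext.addEquiv₀.symm.injective (by simpa using hy)⟩
  · intro h
    refine subsingleton_of_forall_eq 0 fun x => ?_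
    obtain ⟨y, rfl⟩ := Ext.contravariant_sequence_exact₃ hS X x (Ext.eq_zero_of_projective _)
      (n₀ := 0) (by omega)
    obtain ⟨y, rfl⟩ := Ext.addEquiv₀.symm.surjective y
    obtain ⟨z, rfl⟩ := h y
    have : Ext.addEquiv₀.symm (S.f ≫ z) = (Ext.mk₀ S.f).comp (Ext.mk₀ z) (zero_add 0) := by simp
    rw [this]
    exact hS.extClass_comp_assoc _

/-- Baer's criterion in degree `n`. -/
lemma hasInjectiveDimensionLE_of_ideals (X : ModuleCat.{u} R) (n : ℕ)
    (h : ∀ I : Ideal R, Subsingleton (Ext (ModuleCat.of R (R ⧸ I)) X (n + 1))) :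
    HasInjectiveDimensionLE X n := by
  induction n generalizing X with
  | zero =>
    suffices Injective X from by
      change HasInjectiveDimensionLT X 1
      infer_instance
    rw [← Module.injective_iff_injective_object, ← Module.Baer.iff_injective]
    intro I g
    have hex : Function.Exact I.subtype I.mkQ := LinearMap.exact_subtype_mkQ I
    have hS := ModuleCat.shortComplex_shortExact
      (ModuleCat.shortComplexOfCompEqZero _ _ hex.linearMap_comp_eq_zero)
      hex I.injective_subtype (Submodule.mkQ_surjective _)
    have : Projective (ModuleCat.shortComplexOfCompEqZero I.subtype I.mkQ
      hex.linearMap_comp_eq_zero).X₂ :=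
        (IsProjective.iff_projective (R := R) R).1 inferInstance
    obtain ⟨k, hk⟩ := (subsingleton_ext_one_iff hS X).1 (h I) (ModuleCat.ofHom g)
    refine ⟨k.hom, fun r hr => ?_⟩
    exact congrArg (fun q => q.hom ⟨r, hr⟩) hk
  | succ n ih =>
    -- Dimension shift in the second variable: the cosyzygy `J / X` satisfies the hypothesis one
    -- degree lower.
    let ⟨J, _, f, _⟩ := EnoughInjectives.presentation X
    have injf : Function.Injective f.hom := (ModuleCat.mono_iff_injective f).mp ‹_›
    let S : ShortComplex (ModuleCat.{u} R) :=
      ModuleCat.shortComplexOfCompEqZero _ _ f.hom.exact_map_mkQ_range.linearMap_comp_eq_zero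
    have exactS := ModuleCat.shortComplex_shortExact S
      f.hom.exact_map_mkQ_range injf (Submodule.mkQ_surjective _)
    refine (exactS.hasInjectiveDimensionLT_X₃_iff n ‹_›).1 (ih _ fun I => ?_)
    refine subsingleton_of_forall_eq 0 fun x => ?_
    have := h I
    obtain ⟨y, hy⟩ := Ext.covariant_sequence_exact₃ _ exactS x (n₁ := n + 2) rfl
      (Subsingleton.elim (α := Ext (ModuleCat.of R (R ⧸ I)) X (n + 1 + 1)) _ _)
    rw [← hy, Ext.eq_zero_of_injective y, Ext.zero_comp]

end Shift

/-! ### Uniserial modules and their syzygies. -/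

namespace NakayamaSystem

variable {R : Type u} [Ring R] {V : Type w} (D : NakayamaSystem R V)

section Cyclic

variable {M : Type*} [AddCommGroup M] [Module R M]

lemma path_smul_mem {N : Submodule R M} {x : V} {m : M} {n k : ℕ} (h : D.path n x • m ∈ N)
    (hk : n ≤ k) : D.path k x • m ∈ N := by
  obtain ⟨j, rfl⟩ := Nat.exists_eq_add_of_le' hk
  rw [path_add, mul_smul]
  exact N.smul_mem _ h

/-- Once a path sends `m` into `N`, so do all longer ones. The threshold plays the role of the
radical layer of `N`. -/
lemma exists_level (N : Submodule R M) (x : V) (m : M) :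
    ∃ n ≤ D.len x, ∀ k, D.path k x • m ∈ N ↔ n ≤ k := by
  classical
  have h0 : D.path (D.len x) x • m ∈ N := by simp [path_len]
  have hex : ∃ n, D.path n x • m ∈ N := ⟨_, h0⟩
  exact ⟨Nat.find hex, Nat.find_min' hex h0, fun k => ⟨fun h => Nat.find_min' hex h,
    fun h => D.path_smul_mem (Nat.find_spec hex) h⟩⟩

/-- The elements of `R * e x` which send `m` to `N` are multiples of a path. -/
lemma mem_span_path {N : Submodule R M} {x : V} {m : M} {n : ℕ} (hm : D.e x • m = m)
    (hn : ∀ k, D.path k x • m ∈ N → n ≤ k) {r : R} (hr : r • m ∈ N) :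
    r * D.e x ∈ Submodule.span R {D.path n x} := by
  refine D.smul_mem_of_homogeneous fun y s => ?_
  by_cases h0 : D.e y • s • (r * D.e x) = 0
  · rw [h0]; exact Submodule.zero_mem _
  obtain ⟨j, -, -, u, u', h1, h2⟩ := D.exists_eq_mul_path (x := x) (y := y)
    (a := D.e y • s • (r * D.e x)) (by simp only [smul_eq_mul, ← mul_assoc, D.idem])
    (by simp only [smul_eq_mul, mul_assoc, D.idem]) h0
  have hj : n ≤ j := by
    refine hn j ?_
    rw [h2, mul_smul, smul_eq_mul, smul_eq_mul, mul_smul, mul_smul, mul_smul, hm]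
    exact N.smul_mem _ (N.smul_mem _ (N.smul_mem _ hr))
  rw [h1]
  obtain ⟨i, rfl⟩ := Nat.exists_eq_add_of_le' hj
  rw [path_add, ← mul_assoc]
  exact Submodule.smul_mem _ _ (Submodule.mem_span_singleton_self _)

/-- `m` generates `M`, and `M` is isomorphic to the quotient of length `l` of `P(x)`. -/
structure IsGenerator (x : V) (l : ℕ) (m : M) : Prop where
  e_smul : D.e x • m = m
  span_eq_top : Submodule.span R {m} = ⊤
  path_smul_eq_zero_iff : ∀ n, D.path n x • m = 0 ↔ l ≤ n

variable {D}

lemma IsGenerator.le_len {x : V} {l : ℕ} {m : M} (h : D.IsGenerator x l m) : l ≤ D.len x := by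
  rw [← h.path_smul_eq_zero_iff, path_len, zero_smul]

variable (D)

lemma exists_isGenerator {x : V} {m : M} (hm : D.e x • m = m) (hs : Submodule.span R {m} = ⊤) :
    ∃ l, D.IsGenerator x l m := by
  obtain ⟨l, -, hl⟩ := D.exists_level (⊥ : Submodule R M) x m
  exact ⟨l, hm, hs, hl⟩

/-- The generator of the left ideal generated by a path. -/
def pathGen (n : ℕ) (x : V) : Submodule.span R {D.path n x} :=
  ⟨D.path n x, Submodule.mem_span_singleton_self _⟩

/-- With `n` the length of a quotient of `P(x)`, this records its syzygy. Applied twice, it shows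
that second syzygies have top `next x`. -/
lemma isGenerator_pathGen {n : ℕ} {x : V} (hn : n ≤ D.len x) :
    D.IsGenerator ((D.σ ^ n) x) (D.len x - n) (D.pathGen n x) where
  e_smul := Subtype.ext (D.e_mul_path n x)
  span_eq_top := by
    rw [eq_top_iff]
    rintro ⟨r, hr⟩ -
    obtain ⟨t, rfl⟩ := Submodule.mem_span_singleton.1 hr
    exact Submodule.mem_span_singleton.2 ⟨t, rfl⟩
  path_smul_eq_zero_iff k := by
    rw [← Subtype.coe_inj]
    change D.path k _ * D.path n x = 0 ↔ _
    rw [← path_add, path_eq_zero_iff]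
    omega

lemma span_path_le (n : ℕ) (x : V) : Submodule.span R {D.path n x} ≤
    Submodule.span R {D.path 0 x} := by
  rw [Submodule.span_singleton_le_iff_mem]
  exact Submodule.mem_span_singleton.2 ⟨D.path n x, D.path_mul_e n x⟩

lemma mem_span_e_iff {x : V} {r : R} : r ∈ Submodule.span R {D.path 0 x} ↔ r * D.e x = r := by
  rw [Submodule.mem_span_singleton]
  constructor
  · rintro ⟨t, rfl⟩
    simp [mul_assoc, D.idem]
  · exact fun h => ⟨r, h⟩

instance projective_span_e (x : V) : Module.Projective R (Submodule.span R {D.path 0 x}) := by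
  refine Module.Projective.of_split (Submodule.subtype _)
    (LinearMap.toSpanSingleton R (Submodule.span R {D.path 0 x}) (D.pathGen 0 x)) ?_
  ext ⟨r, hr⟩
  exact D.mem_span_e_iff.1 hr

/-- The map from the indecomposable projective module `P(x)` which is given by an element. -/
def fromProj (x : V) (m : M) : Submodule.span R {D.path 0 x} →ₗ[R] M :=
  (LinearMap.toSpanSingleton R M m).comp (Submodule.subtype _)

lemma fromProj_surjective {x : V} {m : M} (hm : D.e x • m = m) (hs : Submodule.span R {m} = ⊤) :
    Function.Surjective (D.fromProj x m) := by
  intro v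
  obtain ⟨t, rfl⟩ := Submodule.mem_span_singleton.1
    (hs ▸ Submodule.mem_top : v ∈ Submodule.span R {m})
  refine ⟨t • D.pathGen 0 x, ?_⟩
  change (t * D.e x) • m = _
  rw [mul_smul, hm]

lemma exact_fromProj {x : V} {l : ℕ} {m : M} (h : D.IsGenerator x l m) :
    Function.Exact (Submodule.inclusion (D.span_path_le l x)) (D.fromProj x m) := by
  rintro ⟨r, hr⟩
  constructor
  · intro h0
    have := D.mem_span_path (N := ⊥) h.e_smul
      (fun k hk => (h.path_smul_eq_zero_iff k).1 hk) (r := r) h0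
    rw [D.mem_span_e_iff.1 hr] at this
    exact ⟨⟨r, this⟩, rfl⟩
  · rintro ⟨⟨s, hs⟩, h2⟩
    obtain ⟨t, rfl⟩ := Submodule.mem_span_singleton.1 hs
    obtain rfl : t • D.path l x = r := congrArg Subtype.val h2
    change (t * D.path l x) • m = 0
    rw [mul_smul, (h.path_smul_eq_zero_iff l).2 le_rfl, smul_zero]

end Cyclic

section Ext

open Abelian

variable {M : ModuleCat.{u} R} {x : V} {l : ℕ} {m : M}

/-- The presentation of a module by the projective cover given by a generator. -/
noncomputable abbrev syzygyComplex (h : D.IsGenerator x l m) : ShortComplex (ModuleCat.{u} R) :=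
  ModuleCat.shortComplexOfCompEqZero (Submodule.inclusion (D.span_path_le l x))
    (D.fromProj x m) (D.exact_fromProj h).linearMap_comp_eq_zero

lemma syzygyComplex_shortExact (h : D.IsGenerator x l m) : (D.syzygyComplex h).ShortExact :=
  ModuleCat.shortComplex_shortExact (D.syzygyComplex h) (D.exact_fromProj h)
    (Submodule.inclusion_injective (D.span_path_le l x))
    (D.fromProj_surjective h.e_smul h.span_eq_top)

instance (h : D.IsGenerator x l m) : Projective (D.syzygyComplex h).X₂ :=
  (IsProjective.iff_projective (R := R) (Submodule.span R {D.path 0 x})).1 inferInstance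

lemma ext_syzygy_iff (h : D.IsGenerator x l m) (X : ModuleCat.{u} R) (n : ℕ) :
    Subsingleton (Ext M X (n + 2)) ↔
      Subsingleton (Ext (ModuleCat.of R (Submodule.span R {D.path l x})) X (n + 1)) :=
  subsingleton_ext_succ_iff (D.syzygyComplex_shortExact h) X n

/-- A homomorphism out of `P(x)` is determined by the image `v` of its generator, so extending `g`
from the syzygy to `P(x)` means dividing its value at the path by that path. -/
lemma ext_one_iff (h : D.IsGenerator x l m) (X : ModuleCat.{u} R) :
    Subsingleton (Ext M X 1) ↔ ∀ g : Submodule.span R {D.path l x} →ₗ[R] X,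
      ∃ v : X, D.path l x • v = g (D.pathGen l x) := by
  refine (subsingleton_ext_one_iff (D.syzygyComplex_shortExact h) X).trans
    ⟨fun H g => ?_, fun H g => ?_⟩
  · obtain ⟨k, hk⟩ := H (ModuleCat.ofHom g)
    refine ⟨k.hom (D.pathGen 0 x), ?_⟩
    have := congrArg (fun q => q.hom (D.pathGen l x)) hk
    refine Eq.trans ?_ this
    rw [← map_smul]
    refine congrArg k.hom (Subtype.ext (D.path_mul_e l x))
  · obtain ⟨v, hv⟩ := H g.hom
    refine ⟨ModuleCat.ofHom (D.fromProj x v), ?_⟩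
    ext ⟨r, hr⟩
    obtain ⟨t, rfl⟩ := Submodule.mem_span_singleton.1 hr
    have : (⟨t • D.path l x, hr⟩ : Submodule.span R {D.path l x}) = t • D.pathGen l x := rfl
    refine Eq.trans ?_ (congrArg g.hom this).symm
    rw [map_smul]
    refine Eq.trans ?_ (congrArg (t • ·) hv)
    change (t * D.path l x) • v = _
    rw [mul_smul]

end Ext

end NakayamaSystem
-- Black vertices and the left self-injective dimension.
namespace NakayamaSystem

variable {R : Type u} [Ring R] {V : Type w} (D : NakayamaSystem R V)

open Abelian

lemma nilpotent_arrow_mul (x : V) (t : R) : IsNilpotent (D.α x * t) := by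
  obtain ⟨n, hn⟩ := D.nilpotent x t
  exact ⟨n + 1, by rw [pow_succ, ← mul_assoc, mul_pow_mul, hn, mul_zero, zero_mul]⟩

lemma eq_zero_of_mul_eq_self {a t : R} (ht : IsNilpotent t) (h : a * t = a) : a = 0 := by
  obtain ⟨n, hn⟩ := ht
  have : ∀ k, a * t ^ k = a := by
    intro k
    induction k with
    | zero => simp
    | succ k ih => rw [pow_succ, ← mul_assoc, ih, h]
  rw [← this n, hn, mul_zero]

lemma eq_zero_of_mul_eq_self' {a t : R} (ht : IsNilpotent t) (h : t * a = a) : a = 0 := by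
  obtain ⟨n, hn⟩ := ht
  have : ∀ k, t ^ k * a = a := by
    intro k
    induction k with
    | zero => simp
    | succ k ih => rw [pow_succ, mul_assoc, h, ih]
  rw [← this n, hn, zero_mul]

section

variable {M : ModuleCat.{u} R} {x : V} {l : ℕ} {m : M}

/-- The value `b` of `g` at the path is killed by the path of length `len x - l`. Up to a right
factor, a homogeneous component of `b` is a path of some length `j` ending at `σ^l x`. If `l ≤ j` it
is divisible by the path from `x`. If `j < l`, it starts further along the orbit, and the relation
makes `P` there so short that `len (σ x) < len x`, against blackness. -/
lemma ext_one_of_black (h : D.IsGenerator x l m) (hx : D.Black x) :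
    Subsingleton (Ext M (ModuleCat.of R R) 1) := by
  rw [D.ext_one_iff h]
  intro g
  change ∃ v : R, D.path l x * v = g (D.pathGen l x)
  set b : R := g (D.pathGen l x) with hb
  have hgen := D.isGenerator_pathGen h.le_len
  have hb1 : D.e ((D.σ ^ l) x) * b = b := by
    rw [hb]
    refine Eq.trans (map_smul g _ _).symm ?_
    rw [hgen.e_smul]
  have hb2 : D.path (D.len x - l) ((D.σ ^ l) x) * b = 0 := by
    rw [hb]
    refine Eq.trans (map_smul g _ _).symm ?_
    rw [(hgen.path_smul_eq_zero_iff _).2 le_rfl, map_zero]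
  suffices ∃ t, b = D.path l x * t from this.imp fun _ h => h.symm
  refine D.exists_eq_mul_of_homogeneous fun z r => ?_
  by_cases h0 : b * r * D.e z = 0
  · exact ⟨0, by rw [h0, mul_zero]⟩
  obtain ⟨j, hj, hjz, s, s', h1, h2⟩ := D.exists_eq_path_mul (x := z) (y := (D.σ ^ l) x)
    (a := b * r * D.e z) (by simp only [← mul_assoc, hb1]) (by rw [mul_assoc, D.idem]) h0
  rcases le_or_gt l j with hlj | hlj
  · obtain ⟨i, rfl⟩ := Nat.exists_eq_add_of_le hlj
    rw [pow_add, Equiv.Perm.mul_apply, EmbeddingLike.apply_eq_iff_eq] at hjz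
    rw [h1, path_add, hjz, mul_assoc]
    exact ⟨_, rfl⟩
  · exfalso
    obtain ⟨i, rfl⟩ := Nat.exists_eq_add_of_lt hlj
    rw [add_assoc, pow_add, Equiv.Perm.mul_apply, EmbeddingLike.apply_eq_iff_eq] at hjz
    have h3 : D.path (D.len x - (j + i + 1) + j) z = 0 := by
      rw [path_add, hjz, ← Equiv.Perm.mul_apply, ← pow_add, ← hjz, h2, ← mul_assoc, ← mul_assoc,
        ← mul_assoc, ← add_assoc, hb2]
      simp
    rw [path_eq_zero_iff, hjz, pow_succ, Equiv.Perm.mul_apply] at h3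
    have h4 := D.len_le_len_add i (D.σ x)
    have h5 := h.le_len
    have h6 : D.len x ≤ D.len (D.σ x) := hx
    omega

/-- For a vertex that is not black, the surjection from `P(σ x)` onto `rad P(x)` is an isomorphism,
and it is right multiplication by the arrow. -/
lemma mul_α_eq_zero (hx : ¬ D.Black x) {s : R} (hs : s * D.e (D.σ x) = s) (h : s * D.α x = 0) :
    s = 0 := by
  have h1 : D.len (D.σ x) < D.len x := not_le.1 hx
  have := D.mem_span_path (N := ⊥) (x := D.σ x) (m := D.α x) (n := D.len (D.σ x)) (D.e_mul_α x)
    (fun k hk => by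
      rw [Submodule.mem_bot, smul_eq_mul, ← path_succ, path_eq_zero_iff] at hk
      omega) (r := s) h
  rw [path_len, hs] at this
  simpa using this

/-- As the arrow can be cancelled on the right, `path l x ↦ path (l - 1) (σ x)` is a well-defined
homomorphism. An extension to `P(x)` would fix a nonzero path under right multiplication by the
nilpotent element `α x * v`. -/
lemma not_ext_one (h : D.IsGenerator x l m) (hl : 0 < l) (hl' : l < D.len x) (hx : ¬ D.Black x) :
    ¬ Subsingleton (Ext M (ModuleCat.of R R) 1) := by
  rw [D.ext_one_iff h]
  intro H
  obtain ⟨l, rfl⟩ := Nat.exists_eq_succ_of_ne_zero hl.ne'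
  have hker : ∀ c : R, c • D.path (l + 1) x = 0 → c • D.path l (D.σ x) = 0 := by
    intro c hc
    refine D.mul_α_eq_zero hx (by rw [smul_eq_mul, mul_assoc, path_mul_e]) ?_
    rwa [smul_eq_mul, mul_assoc, ← path_succ]
  obtain ⟨v, hv⟩ := H (LinearPMap.mkSpanSingleton' _ _ hker).toFun
  replace hv : D.path (l + 1) x * v = D.path l (D.σ x) := by
    refine Eq.trans hv ?_
    exact LinearPMap.mkSpanSingleton'_apply_self _ _ hker _
  rw [path_succ, mul_assoc] at hv
  have := eq_zero_of_mul_eq_self (D.nilpotent_arrow_mul x v) hv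
  rw [path_eq_zero_iff] at this
  have := D.len_le_len_add 1 x
  have : D.len x ≤ D.len (D.σ x) + 1 := this
  rw [Nat.succ_eq_add_one] at hl'
  omega

end

/-- Passing to the second syzygy replaces the top `x` by `next x`; the length is irrelevant for the
vanishing. -/
lemma ext_of_iterate_black (k : ℕ) : ∀ {M : ModuleCat.{u} R} {x : V} {l : ℕ} {m : M},
    D.IsGenerator x l m → D.Black (D.next^[k] x) →
      Subsingleton (Ext M (ModuleCat.of R R) (2 * k + 1)) := by
  induction k with
  | zero => exact fun h hx => D.ext_one_of_black h hx
  | succ k ih =>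
    intro M x l m h hx
    change Subsingleton (Ext M (ModuleCat.of R R) (2 * k + 1 + 2))
    rw [D.ext_syzygy_iff h]
    have h1 := D.isGenerator_pathGen h.le_len
    change Subsingleton (Ext _ (ModuleCat.of R R) (2 * k + 2))
    rw [D.ext_syzygy_iff (M := ModuleCat.of R _) h1]
    have h2 := D.isGenerator_pathGen h1.le_len
    refine ih (M := ModuleCat.of R _) h2 ?_
    rw [← Equiv.Perm.mul_apply, ← pow_add, Nat.sub_add_cancel h.le_len]
    exact hx

/-- When `σ^t x = x`, the module of length `t` has first syzygy `(x, len x - t)` and second syzygy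
`(next x, t)`, and `t` is again a period at `next x`. No syzygy is zero or projective, so
`not_ext_one` applies in every degree. The top changes only at every second step, whence `n / 2`. -/
lemma iterate_black_of_ext {t : ℕ} (ht : 0 < t) (htl : ∀ x, t < D.len x) (n : ℕ) :
    ∀ {M : ModuleCat.{u} R} {x : V} {m : M}, D.IsGenerator x t m → (D.σ ^ t) x = x →
      Subsingleton (Ext M (ModuleCat.of R R) (n + 1)) → D.Black (D.next^[n / 2] x) := by
  induction n using Nat.twoStepInduction with
  | zero =>
    intro M x m h hx hM
    by_contra hb
    exact D.not_ext_one h ht (htl x) hb hM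
  | one =>
    intro M x m h hx hM
    rw [D.ext_syzygy_iff h] at hM
    by_contra hb
    have h1 := D.isGenerator_pathGen h.le_len
    rw [hx] at h1
    have := htl x
    exact D.not_ext_one (M := ModuleCat.of R _) h1 (by omega) (by omega) hb hM
  | more n ih _ =>
    intro M x m h hx hM
    have h1 := D.isGenerator_pathGen h.le_len
    have hnext : (D.σ ^ (D.len x - t)) x = D.next x := by
      have h3 := congrArg (D.σ ^ (D.len x - t)) hx
      rw [← Equiv.Perm.mul_apply, ← pow_add, Nat.sub_add_cancel h.le_len] at h3
      exact h3.symm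
    rw [hx] at h1
    have h2 := D.isGenerator_pathGen h1.le_len
    rw [D.ext_syzygy_iff (n := n + 1) h, D.ext_syzygy_iff (n := n) (M := ModuleCat.of R _) h1] at hM
    rw [hnext, Nat.sub_sub_self h.le_len] at h2
    rw [Nat.add_div_right n two_pos]
    refine ih (M := ModuleCat.of R _) h2 ?_ hM
    rw [← hnext, ← Equiv.Perm.mul_apply, ← pow_add, add_comm, pow_add, Equiv.Perm.mul_apply, hx]

/-- An indecomposable module of a given length. -/
lemma exists_module (x : V) {t : ℕ} (ht : t ≤ D.len x) :
    ∃ (M : ModuleCat.{u} R) (m : M), D.IsGenerator x t m := by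
  refine ⟨ModuleCat.of R (Submodule.span R {D.path 0 x} ⧸
    (Submodule.span R {D.path t x}).submoduleOf (Submodule.span R {D.path 0 x})),
    Submodule.Quotient.mk (D.pathGen 0 x), ?_, ?_, fun n => ?_⟩
  · rw [← Submodule.Quotient.mk_smul]
    exact congrArg _ (Subtype.ext (D.idem x))
  · rw [eq_top_iff]
    rintro q -
    obtain ⟨⟨r, hr⟩, rfl⟩ := Submodule.Quotient.mk_surjective _ q
    refine Submodule.mem_span_singleton.2 ⟨r, ?_⟩
    rw [← Submodule.Quotient.mk_smul]
    exact congrArg _ (Subtype.ext (D.mem_span_e_iff.1 hr))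
  · rw [← Submodule.Quotient.mk_smul, Submodule.Quotient.mk_eq_zero, Submodule.submoduleOf,
      Submodule.mem_comap]
    change D.path n x * D.e x ∈ _ ↔ _
    rw [path_mul_e, Submodule.mem_span_singleton]
    constructor
    · rintro ⟨r, hr⟩
      by_contra hlt
      rw [not_le] at hlt
      obtain ⟨i, rfl⟩ := Nat.exists_eq_add_of_lt hlt
      -- A path that is a multiple of a longer one equals a nilpotent element times itself.
      have h0 : D.path n x = 0 := by
        refine eq_zero_of_mul_eq_self' (D.nilpotent ((D.σ ^ n) x)
          (r * D.path i ((D.σ ^ (n + 1)) x))) ?_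
        rw [mul_assoc, ← path_succ_eq, mul_assoc, ← path_add, add_comm, add_right_comm]
        exact hr
      rw [path_eq_zero_iff] at h0
      omega
    · intro h
      obtain ⟨j, rfl⟩ := Nat.exists_eq_add_of_le' h
      exact ⟨D.path j ((D.σ ^ t) x), by rw [path_add]; rfl⟩

lemma exists_e_smul_ne_zero {M : Type*} [AddCommGroup M] [Module R M] [Nontrivial M] :
    ∃ (x : V) (m : M), D.e x • m = m ∧ m ≠ 0 := by
  by_contra! H
  obtain ⟨m, hm⟩ := exists_ne (0 : M)
  refine hm ((Submodule.mem_bot R).1 (D.smul_mem_of_homogeneous fun x r => ?_))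
  exact (Submodule.mem_bot R).2 (H x _ (by rw [← mul_smul, D.idem]))

/-- Vanishing on the indecomposable modules implies vanishing on the cyclic modules. -/
lemma ext_quotient [IsNoetherianRing R] (X : ModuleCat.{u} R) (n : ℕ)
    (H : ∀ {M : ModuleCat.{u} R} {x : V} {l : ℕ} {m : M}, D.IsGenerator x l m →
      Subsingleton (Ext M X n)) (I : Ideal R) :
    Subsingleton (Ext (ModuleCat.of R (R ⧸ I)) X n) := by
  -- Noetherian induction: `R ⧸ I` contains a nonzero cyclic module with a generator, and dividing
  -- it out replaces `I` by a larger ideal.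
  induction I using WellFoundedGT.induction with
  | _ I ih =>
    by_cases hI : I = ⊤
    · subst hI
      refine subsingleton_of_forall_eq 0 fun x => ?_
      have h0 : (𝟙 (ModuleCat.of R (R ⧸ (⊤ : Ideal R)))) = 0 := by
        ext
        exact Subsingleton.elim (α := R ⧸ (⊤ : Ideal R)) _ _
      rw [← Ext.mk₀_id_comp x, h0, Ext.mk₀_zero, Ext.zero_comp]
    have : Nontrivial (R ⧸ I) := Submodule.Quotient.nontrivial_iff.2 hI
    obtain ⟨x, m, hm, hm0⟩ := D.exists_e_smul_ne_zero (M := R ⧸ I)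
    set N := Submodule.span R {m}
    obtain ⟨l, hl⟩ := D.exists_isGenerator (M := N) (x := x)
      (m := ⟨m, Submodule.mem_span_singleton_self m⟩) (Subtype.ext hm) (by
        rw [eq_top_iff]
        rintro ⟨r, hr⟩ -
        obtain ⟨t, rfl⟩ := Submodule.mem_span_singleton.1 hr
        exact Submodule.mem_span_singleton.2 ⟨t, rfl⟩)
    have h1 := H (M := ModuleCat.of R N) hl
    let g : (R ⧸ I) →ₗ[R] R ⧸ N.comap I.mkQ := I.mapQ _ LinearMap.id fun r hr => by
      change I.mkQ r ∈ N
      rw [Submodule.mkQ_apply, (Submodule.Quotient.mk_eq_zero I).2 hr]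
      exact N.zero_mem
    have hlt : I < N.comap I.mkQ := by
      refine lt_of_le_of_ne (fun r hr => ?_) fun h => hm0 ?_
      · change I.mkQ r ∈ N
        rw [Submodule.mkQ_apply, (Submodule.Quotient.mk_eq_zero I).2 hr]
        exact N.zero_mem
      · obtain ⟨r, rfl⟩ := Submodule.Quotient.mk_surjective _ m
        refine (Submodule.Quotient.mk_eq_zero I).2 ?_
        rw [h]
        exact Submodule.mem_span_singleton_self _
    have h2 := ih _ hlt
    have hex : Function.Exact N.subtype g := by
      intro q
      obtain ⟨r, rfl⟩ := Submodule.Quotient.mk_surjective _ q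
      change Submodule.Quotient.mk r = 0 ↔ _
      rw [Submodule.Quotient.mk_eq_zero, Submodule.mem_comap]
      simp
    have hS := ModuleCat.shortComplex_shortExact
      (ModuleCat.shortComplexOfCompEqZero _ _ hex.linearMap_comp_eq_zero) hex N.injective_subtype
      (by
        intro q
        obtain ⟨r, rfl⟩ := Submodule.Quotient.mk_surjective _ q
        exact ⟨Submodule.Quotient.mk r, rfl⟩)
    refine subsingleton_of_forall_eq 0 fun y => ?_
    obtain ⟨z, hz⟩ := Ext.contravariant_sequence_exact₂ hS X y (Subsingleton.elim (h := h1) _ _)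
    rw [← hz, Subsingleton.elim (h := h2) z 0, Ext.comp_zero]

/-- The left self-injective dimension. -/
theorem hasInjectiveDimensionLE_iff [IsNoetherianRing R]
    (hp : ∀ x, ∃ t, 0 < t ∧ (D.σ ^ t) x = x ∧ ∀ y, t < D.len y) (n : ℕ) :
    HasInjectiveDimensionLE (ModuleCat.of R R) n ↔ ∀ x, D.Black (D.next^[n / 2] x) := by
  constructor
  · intro h x
    obtain ⟨t, ht, htx, htl⟩ := hp x
    obtain ⟨M, m, hM⟩ := D.exists_module x (htl x).le
    exact D.iterate_black_of_ext ht htl n hM htx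
      (HasInjectiveDimensionLT.subsingleton _ (n + 1) _ le_rfl _)
  · intro h
    -- The criterion yields the even bound below `n`; this is why the dimension is even.
    have : HasInjectiveDimensionLE (ModuleCat.of R R) (2 * (n / 2)) :=
      hasInjectiveDimensionLE_of_ideals _ _ fun I =>
        D.ext_quotient _ _ (fun hM => D.ext_of_iterate_black _ hM (h _)) I
    exact hasInjectiveDimensionLT_of_ge _ (2 * (n / 2) + 1) (n + 1) (by omega)

end NakayamaSystem

/-! ### Combinatorics of the successor map and left-right symmetry. -/

/-- For a Galois connection between integer-valued functions, strict growth on the image of an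
iterate passes from the lower to the upper adjoint. -/
lemma upper_strict_of_lower_strict {F G : ℤ → ℤ} (hF : GaloisConnection F G) {m : ℕ}
    (h1 : ∀ i, F (F^[m] i) < F (F^[m] i + 1))
    (h2 : ∀ i, ∃ b, F^[2 * m + 1] b = F^[m] i) (j : ℤ) : G (G^[m] j - 1) < G (G^[m] j) := by
  have hgc : ∀ n, ∀ i j, F^[n] i ≤ j ↔ i ≤ G^[n] j := by
    intro n
    induction n with
    | zero => exact fun _ _ => Iff.rfl
    | succ n ih =>
      intro i j
      rw [Function.iterate_succ_apply, Function.iterate_succ_apply', ih]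
      exact hF _ _
  set u := G^[m] j
  obtain ⟨b, hb⟩ := h2 u
  set w := F^[m] (F b) with hw
  have hz : w = F (F^[m] b) := by
    rw [hw, ← Function.iterate_succ_apply, Function.iterate_succ_apply']
  have hwu : F^[m] w = F^[m] u := by
    rw [hw, ← Function.iterate_add_apply, ← Function.iterate_succ_apply, ← hb]
    congr 2
    omega
  have hstep : ∀ k, F^[k] w < F^[k] (w + 1) := by
    intro k
    induction k with
    | zero => exact Int.lt_succ w
    | succ k ih =>
      rw [Function.iterate_succ_apply', Function.iterate_succ_apply']
      have h3 := h1 (F^[k] (F b))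
      rw [← Function.iterate_add_apply, add_comm m k, Function.iterate_add_apply, ← hw] at h3
      exact h3.trans_le (hF.monotone_l ih)
  have hwle : w ≤ u := by
    rw [← hgc, hwu, hgc]
  have hule : u ≤ w := by
    by_contra! h
    have := (hF.monotone_l.iterate m) (Int.add_one_le_iff.2 h)
    have := hstep m
    omega
  have huw : F (F^[m] b) = u := by omega
  have h4 : F^[m] b ≤ G u := (hF _ _).1 huw.le
  have h5 : ¬ F^[m] b ≤ G (u - 1) := fun h => by
    have := (hF _ _).2 h
    omega
  omega

namespace NakayamaSystem

variable {R : Type u} [Ring R] {V : Type w} (D : NakayamaSystem R V)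

/-- The lift of the successor map of the resolution quiver along `i ↦ σ ^ i x`. -/
noncomputable def lift (x : V) (i : ℤ) : ℤ := i + D.len ((D.σ ^ i) x)

lemma pow_lift (x : V) (i : ℤ) : (D.σ ^ D.lift x i) x = D.next ((D.σ ^ i) x) := by
  rw [lift, add_comm, zpow_add, Equiv.Perm.mul_apply, zpow_natCast]
  rfl

lemma pow_iterate_lift (x : V) (i : ℤ) (n : ℕ) :
    (D.σ ^ (D.lift x)^[n] i) x = D.next^[n] ((D.σ ^ i) x) := by
  induction n with
  | zero => rfl
  | succ n ih => rw [Function.iterate_succ_apply', pow_lift, ih, Function.iterate_succ_apply']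

lemma σ_zpow (x : V) (i : ℤ) : D.σ ((D.σ ^ i) x) = (D.σ ^ (i + 1)) x := by
  rw [add_comm, zpow_add, zpow_one, Equiv.Perm.mul_apply]

lemma black_zpow_iff (x : V) (i : ℤ) : D.Black ((D.σ ^ i) x) ↔ D.lift x i < D.lift x (i + 1) := by
  rw [Black, lift, lift, σ_zpow]
  omega

lemma lift_monotone (x : V) : Monotone (D.lift x) := by
  refine monotone_int_of_le_succ fun i => ?_
  have := D.len_le_len_add 1 ((D.σ ^ i) x)
  rw [pow_one, σ_zpow] at this
  rw [lift, lift]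
  omega

lemma lift_sub (x : V) {d : ℤ} (hd : (D.σ ^ d) x = x) (i : ℤ) :
    D.lift x (i - d) = D.lift x i - d := by
  have : (D.σ ^ (i - d)) x = (D.σ ^ i) x := by
    conv_lhs => rw [← hd]
    rw [← Equiv.Perm.mul_apply, ← zpow_add, sub_add_cancel]
  rw [lift, lift, this]
  ring

lemma iterate_lift_sub (x : V) {d : ℤ} (hd : (D.σ ^ d) x = x) (i : ℤ) (n : ℕ) :
    (D.lift x)^[n] (i - d) = (D.lift x)^[n] i - d := by
  induction n with
  | zero => rfl
  | succ n ih =>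
    rw [Function.iterate_succ_apply', ih, lift_sub _ _ hd, Function.iterate_succ_apply']

/-- The successor map is injective on black vertices. -/
lemma eq_of_next_eq {a b : V} (ha : D.Black a) (hb : D.Black b) (h : D.next a = D.next b) :
    a = b := by
  -- The signed distance from `a` to `b` along the orbit for which the lift agrees at `0` and `k`.
  -- Monotonicity and a strict step after each of the two points force `k = 0`.
  set k : ℤ := -(D.len b : ℤ) + D.len a with hk
  have hbk : (D.σ ^ k) a = b := by
    rw [hk, zpow_add, Equiv.Perm.mul_apply, zpow_natCast]
    change (D.σ ^ _) (D.next a) = _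
    rw [h, next, zpow_neg, zpow_natCast, ← Equiv.Perm.mul_apply, inv_mul_cancel,
      Equiv.Perm.one_apply]
  have h0 : D.lift a 0 = D.len a := by simp [lift]
  have h1 : D.lift a k = D.len a := by
    rw [lift, hbk]
    omega
  rw [← hbk, black_zpow_iff] at hb
  have ha' : D.Black ((D.σ ^ (0 : ℤ)) a) := ha
  rw [black_zpow_iff] at ha'
  rcases lt_trichotomy k 0 with hk0 | hk0 | hk0
  · have := D.lift_monotone a (Int.add_one_le_iff.2 hk0)
    omega
  · rw [hk0] at hbk
    exact hbk
  · have := D.lift_monotone a (Int.add_one_le_iff.2 hk0)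
    omega

/-- The vertices reached after `m` steps are black if and only if all periodic vertices are black
and all vertices become periodic after `m` steps. -/
lemma forall_black_iff [Finite V] (m : ℕ) :
    (∀ x, D.Black (D.next^[m] x)) ↔ (∀ x ∈ Function.periodicPts D.next, D.Black x) ∧
      ∀ x, D.next^[m] x ∈ Function.periodicPts D.next := by
  constructor
  · intro h
    refine ⟨fun x hx => ?_, fun x => ?_⟩
    · obtain ⟨n, hn, hx⟩ := hx
      have h1 : D.next^[m * n] x = x := (hx.const_mul m)
      obtain ⟨j, hj⟩ := Nat.exists_eq_add_of_le (Nat.le_mul_of_pos_right m hn)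
      rw [hj, Function.iterate_add_apply] at h1
      rw [← h1]
      exact h _
    -- The image of `next^[m]` is stable under `next` and all black, so every iterate of `next` is
    -- injective on it; finiteness then gives periodicity.
    · have hinj : ∀ i a b, D.next^[i] (D.next^[m] a) = D.next^[i] (D.next^[m] b) →
          D.next^[m] a = D.next^[m] b := by
        intro i
        induction i with
        | zero => exact fun a b h => h
        | succ i ih =>
          intro a b hab
          refine D.eq_of_next_eq (h a) (h b) ?_
          have hc : ∀ y, D.next (D.next^[m] y) = D.next^[m] (D.next y) := fun y =>
            (Function.iterate_succ_apply' D.next m y).symm.trans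
              (Function.iterate_succ_apply D.next m y)
          rw [Function.iterate_succ_apply, Function.iterate_succ_apply, hc, hc] at hab
          rw [hc, hc]
          exact ih _ _ hab
      obtain ⟨i, j, hij, he⟩ := Finite.exists_ne_map_eq_of_infinite
        fun i => D.next^[i] (D.next^[m] x)
      wlog hlt : i < j generalizing i j
      · exact this j i hij.symm he.symm (by omega)
      obtain ⟨k, rfl⟩ := Nat.exists_eq_add_of_lt hlt
      have he' : D.next^[i] (D.next^[m] x) = D.next^[i] (D.next^[m] (D.next^[k + 1] x)) := by
        refine he.trans ?_
        simp only [← Function.iterate_add_apply]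
        exact congrArg (fun t => D.next^[t] x) (by omega)
      refine ⟨k + 1, by omega, ?_⟩
      change D.next^[k + 1] (D.next^[m] x) = _
      rw [← Function.iterate_add_apply, add_comm, Function.iterate_add_apply]
      exact (hinj _ _ _ he').symm
  · exact fun h x => h.1 _ (h.2 x)

lemma σ_symm_pow_zpow (x : V) (n : ℕ) (j : ℤ) :
    (D.σ.symm ^ n) ((D.σ ^ j) x) = (D.σ ^ (j - n)) x := by
  rw [← Equiv.Perm.inv_def, sub_eq_neg_add, zpow_add, Equiv.Perm.mul_apply, zpow_neg, zpow_natCast,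
    inv_pow]

/-- The lift of the successor map of the opposite system. -/
noncomputable def oppLift (x : V) (j : ℤ) : ℤ := j - D.opp.len ((D.σ ^ j) x)

/-- For `i ≤ j`, both inequalities say that the path from position `i` to position `j` vanishes. For
`j < i` both fail, since lengths are positive. -/
lemma galoisConnection_lift (x : V) : GaloisConnection (D.lift x) (D.oppLift x) := by
  intro i j
  have h1 := D.len_pos ((D.σ ^ i) x)
  have h2 := D.opp.len_pos ((D.σ ^ j) x)
  rw [lift, oppLift]
  rcases lt_or_ge j i with hji | hij
  · omega
  · obtain ⟨n, rfl⟩ := Int.le.dest hij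
    have := D.opp_len_le_iff n ((D.σ ^ i) x)
    rw [← Equiv.Perm.mul_apply, ← zpow_natCast, ← zpow_add, add_comm] at this
    omega

lemma pow_oppLift (x : V) (j : ℤ) : (D.σ ^ D.oppLift x j) x = D.opp.next ((D.σ ^ j) x) := by
  change _ = (D.σ.symm ^ _) _
  rw [σ_symm_pow_zpow]
  rfl

lemma pow_iterate_oppLift (x : V) (j : ℤ) (n : ℕ) :
    (D.σ ^ (D.oppLift x)^[n] j) x = D.opp.next^[n] ((D.σ ^ j) x) := by
  induction n with
  | zero => rfl
  | succ n ih => rw [Function.iterate_succ_apply', pow_oppLift, ih, Function.iterate_succ_apply']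

lemma opp_black_zpow_iff (x : V) (j : ℤ) :
    D.opp.Black ((D.σ ^ j) x) ↔ D.oppLift x (j - 1) < D.oppLift x j := by
  have := D.σ_symm_pow_zpow x 1 j
  rw [pow_one, Nat.cast_one] at this
  change _ ≤ D.opp.len (D.σ.symm _) ↔ _
  rw [this, oppLift, oppLift]
  omega

/-- Blackness is strict growth of the lift to the right for `D`, and to the left for `D.opp`. The
adjunction turns the former into the latter. -/
lemma opp_black_of_black [Finite V] {m : ℕ} (h : ∀ x, D.Black (D.next^[m] x)) (x : V) :
    D.opp.Black (D.opp.next^[m] x) := by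
  have := D.pow_iterate_oppLift x 0 m
  rw [zpow_zero, Equiv.Perm.one_apply] at this
  rw [← this, opp_black_zpow_iff]
  refine upper_strict_of_lower_strict (D.galoisConnection_lift x) (fun i => ?_) (fun i => ?_) 0
  · rw [← black_zpow_iff, pow_iterate_lift]
    exact h _
  · obtain ⟨n, hn, hx⟩ := ((D.forall_black_iff m).1 h).2 ((D.σ ^ i) x)
    set a := (D.lift x)^[m] i with ha
    set N := (2 * m + 1) * n
    have h1 : D.next^[N] ((D.σ ^ a) x) = (D.σ ^ a) x := by
      rw [ha, pow_iterate_lift]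
      exact hx.const_mul (2 * m + 1)
    rw [← pow_iterate_lift] at h1
    obtain ⟨j, hj⟩ := Nat.exists_eq_add_of_le (Nat.le_mul_of_pos_right (2 * m + 1) hn)
    have hd : (D.σ ^ ((D.lift x)^[N] a - a)) x = x := by
      rw [sub_eq_neg_add, zpow_add, Equiv.Perm.mul_apply, h1, ← Equiv.Perm.mul_apply, ← zpow_add,
        neg_add_cancel]
      rfl
    -- `N` steps move `a` by a period of the orbit. Starting one period earlier gives an exact
    -- preimage of `a` under `N ≥ 2m + 1` steps.
    refine ⟨(D.lift x)^[j] (a - ((D.lift x)^[N] a - a)), ?_⟩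
    rw [← Function.iterate_add_apply, ← hj, iterate_lift_sub _ _ hd]
    ring

lemma opp_opp_len (x : V) : D.opp.opp.len x = D.len x := by
  refine eq_of_forall_ge_iff fun n => ?_
  have h1 := D.opp.opp_len_le_iff n ((D.σ ^ n) x)
  rw [D.opp_len_le_iff] at h1
  rw [← h1]
  change _ ↔ D.opp.opp.len ((D.σ⁻¹ ^ n) ((D.σ ^ n) x)) ≤ n
  rw [← Equiv.Perm.mul_apply, inv_pow, inv_mul_cancel, Equiv.Perm.one_apply]

lemma opp_black_iff [Finite V] (m : ℕ) :
    (∀ x, D.opp.Black (D.opp.next^[m] x)) ↔ ∀ x, D.Black (D.next^[m] x) := by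
  refine ⟨fun h x => ?_, fun h => D.opp_black_of_black h⟩
  have h1 := D.opp.opp_black_of_black h x
  have hnext : D.opp.opp.next = D.next := by
    funext y
    rw [next, next, opp_opp_len]
    rfl
  rw [hnext, Black, opp_opp_len, opp_opp_len] at h1
  exact h1

end NakayamaSystem

/-! ### Idempotents and the tops of uniserial projective modules. -/

section Idempotents

variable {R : Type u} [Ring R]

lemma mul_eq_of_mem_span {e : R} (he : e * e = e) {a : R} (ha : a ∈ Submodule.span R {e}) :
    a * e = a := by
  obtain ⟨t, rfl⟩ := Submodule.mem_span_singleton.1 ha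
  rw [smul_eq_mul, mul_assoc, he]

lemma mem_span_of_mul_eq {e a : R} (ha : a * e = a) : a ∈ Submodule.span R {e} :=
  Submodule.mem_span_singleton.2 ⟨a, ha⟩

/-- The generator of the left ideal generated by an element. -/
abbrev spanGen (e : R) : Submodule.span R {e} := ⟨e, Submodule.mem_span_singleton_self e⟩

lemma eq_top_of_spanGen_mem {e : R} {N : Submodule R (Submodule.span R {e})}
    (h : spanGen e ∈ N) : N = ⊤ := by
  rw [eq_top_iff]
  rintro ⟨r, hr⟩ -
  obtain ⟨t, rfl⟩ := Submodule.mem_span_singleton.1 hr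
  exact N.smul_mem t h

/-- Direct sum decompositions of `R * e` come from idempotents. -/
lemma exists_idempotents_of_isCompl {e : R} (he : e * e = e)
    {N N' : Submodule R (Submodule.span R {e})} (h : IsCompl N N') :
    ∃ a b : Submodule.span R {e}, a ∈ N ∧ b ∈ N' ∧ (a : R) + b = e ∧ (a : R) * a = a ∧
      (b : R) * b = b ∧ e * (a : R) = a := by
  have hs : spanGen e ∈ N ⊔ N' := by rw [h.sup_eq_top]; trivial
  obtain ⟨a, ha, b, hb, hab⟩ := Submodule.mem_sup.1 hs
  have hab' : (a : R) + b = e := congrArg Subtype.val hab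
  have hae := mul_eq_of_mem_span he a.2
  have hbe := mul_eq_of_mem_span he b.2
  have hdis : ∀ c : Submodule.span R {e}, c ∈ N → c ∈ N' → (c : R) = 0 := fun c h1 h2 => by
    have : c ∈ N ⊓ N' := ⟨h1, h2⟩
    rw [h.inf_eq_bot, Submodule.mem_bot] at this
    rw [this]; rfl
  have h1 : (a : R) * b = 0 := by
    refine hdis ((a : R) • b) ?_ (N'.smul_mem _ hb)
    have : (a : R) • b = a - (a : R) • a := by
      refine Subtype.ext ?_
      change (a : R) * b = a - a * a
      rw [eq_sub_iff_add_eq', ← mul_add, hab', hae]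
    rw [this]
    exact N.sub_mem ha (N.smul_mem _ ha)
  have h2 : (b : R) * a = 0 := by
    refine hdis ((b : R) • a) (N.smul_mem _ ha) ?_
    have : (b : R) • a = b - (b : R) • b := by
      refine Subtype.ext ?_
      change (b : R) * a = b - b * b
      rw [eq_sub_iff_add_eq, ← mul_add, hab', hbe]
    rw [this]
    exact N'.sub_mem hb (N'.smul_mem _ hb)
  refine ⟨a, b, ha, hb, hab', ?_, ?_, ?_⟩
  · have : (a : R) * (a + b) = a * a := by rw [mul_add, h1, add_zero]
    rw [← this, hab', hae]
  · have : (b : R) * (a + b) = b * b := by rw [mul_add, h2, zero_add]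
    rw [← this, hab', hbe]
  · have h3 : ((a : R) + b) * a = a * (a + b) := by rw [add_mul, mul_add, h1, h2]
    rwa [hab', hae] at h3

lemma isIndecomposable_span {e : R} (he : e * e = e) (h0 : e ≠ 0)
    (H : ∀ f : R, f * f = f → e * f = f → f * e = f → f = 0 ∨ f = e) :
    IsIndecomposable R (Submodule.span R {e}) := by
  refine ⟨⟨spanGen e, 0, fun h => h0 (congrArg Subtype.val h)⟩, fun N N' hN => ?_⟩
  obtain ⟨a, b, ha, hb, hab, haa, -, hea⟩ := exists_idempotents_of_isCompl he hN
  rcases H a haa hea (mul_eq_of_mem_span he a.2) with h | h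
  · left
    have : N' = ⊤ := eq_top_of_spanGen_mem (by
      have : spanGen e = b := Subtype.ext (hab.symm.trans (by rw [h, zero_add]))
      rwa [this])
    simpa [this] using hN.inf_eq_bot
  · right
    have : N = ⊤ := eq_top_of_spanGen_mem (by
      have : spanGen e = a := Subtype.ext h.symm
      rwa [this])
    simpa [this] using hN.inf_eq_bot

/-- Every simple module is the top of an indecomposable projective module given by an
idempotent. -/
lemma exists_idempotent_of_simple [IsArtinianRing R] (S : Type*) [AddCommGroup S] [Module R S]
    [IsSimpleModule R S] :
    ∃ e : R, e * e = e ∧ (∃ v : S, e • v = v ∧ v ≠ 0) ∧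
      IsIndecomposable R (Submodule.span R {e}) := by
  have := IsSimpleModule.nontrivial R S
  obtain ⟨v0, hv0⟩ := exists_ne (0 : S)
  -- Among the idempotents acting nontrivially on `S`, one with minimal `R * e` is taken. In any
  -- decomposition of `R * e`, one of the two idempotents still acts nontrivially.
  obtain ⟨_, ⟨e, he, v, hv, rfl⟩, hmin⟩ := (wellFounded_lt (α := Submodule R R)).has_min
    {I | ∃ e : R, e * e = e ∧ ∃ v : S, e • v ≠ 0 ∧ I = Submodule.span R {e}}
    ⟨_, 1, one_mul 1, v0, by simpa using hv0, rfl⟩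
  refine ⟨e, he, ⟨e • v, by rw [← mul_smul, he], hv⟩,
    ⟨spanGen e, 0, fun h => hv (by rw [show e = 0 from congrArg Subtype.val h, zero_smul])⟩,
    fun N N' hN => ?_⟩
  have key : ∀ (N : Submodule R (Submodule.span R {e})) (a : Submodule.span R {e}), a ∈ N →
      (a : R) * a = a → (a : R) • v ≠ 0 → N = ⊤ := by
    intro N a ha haa hav
    refine eq_top_of_spanGen_mem ?_
    have hle : Submodule.span R {(a : R)} ≤ Submodule.span R {e} :=
      (Submodule.span_singleton_le_iff_mem _ _).2 a.2
    have hnot := hmin _ ⟨a, haa, v, hav, rfl⟩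
    have heq := hle.eq_of_not_lt hnot
    have : e ∈ Submodule.span R {(a : R)} := by
      rw [heq]
      exact Submodule.mem_span_singleton_self e
    obtain ⟨t, ht⟩ := Submodule.mem_span_singleton.1 this
    have h2 : spanGen e = t • a := Subtype.ext ht.symm
    rw [h2]
    exact N.smul_mem t ha
  obtain ⟨a, b, ha, hb, hab, haa, hbb, -⟩ := exists_idempotents_of_isCompl he hN
  by_cases hav : (a : R) • v = 0
  · have hbv : (b : R) • v ≠ 0 := fun h => hv (by rw [← hab, add_smul, hav, h, add_zero])
    left
    simpa [key N' b hb hbb hbv] using hN.inf_eq_bot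
  · right
    simpa [key N a ha haa hav] using hN.inf_eq_bot

lemma IsUniserial.eq_mul_or {e : R} (h : IsUniserial R (Submodule.span R {e})) {a b : R}
    (ha : a * e = a) (hb : b * e = b) : (∃ r, a = r * b) ∨ ∃ r, b = r * a := by
  let a' : Submodule.span R {e} := ⟨a, mem_span_of_mul_eq ha⟩
  let b' : Submodule.span R {e} := ⟨b, mem_span_of_mul_eq hb⟩
  rcases h (Submodule.span R {a'}) (Submodule.span R {b'}) with h | h
  · obtain ⟨r, hr⟩ := Submodule.mem_span_singleton.1 ((Submodule.span_singleton_le_iff_mem _ _).1 h)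
    exact Or.inl ⟨r, (congrArg Subtype.val hr).symm⟩
  · obtain ⟨r, hr⟩ := Submodule.mem_span_singleton.1 ((Submodule.span_singleton_le_iff_mem _ _).1 h)
    exact Or.inr ⟨r, (congrArg Subtype.val hr).symm⟩

lemma projective_span {e : R} (he : e * e = e) : Module.Projective R (Submodule.span R {e}) := by
  refine Module.Projective.of_split (Submodule.subtype _)
    (LinearMap.toSpanSingleton R (Submodule.span R {e}) (spanGen e)) ?_
  ext ⟨r, hr⟩
  exact mul_eq_of_mem_span he hr

/-- `R * e` is uniserial, and the element `v` of a simple module shows that this simple module is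
its top. -/
structure IsTop {S : Type*} [AddCommGroup S] [Module R S] (e : R) (v : S) : Prop where
  idem : e * e = e
  smul_eq : e • v = v
  ne_zero : v ≠ 0
  uniserial : ∀ a b, a * e = a → b * e = b → (∃ r, a = r * b) ∨ ∃ r, b = r * a

namespace IsTop

variable {S : Type*} [AddCommGroup S] [Module R S] {e : R} {v : S}

/-- Being the top of `R * e` only depends on the simple module. -/
lemma of_smul_eq {S' : Type*} [AddCommGroup S'] [Module R S'] (h : IsTop e v) {w : S'}
    (hw : e • w = w) (hw0 : w ≠ 0) : IsTop e w :=
  ⟨h.idem, hw, hw0, h.uniserial⟩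

variable [IsSimpleModule R S]

/-- Choose `t` with `t a v = v` and compare `e t a` with `e - e t a` by uniseriality. The second
kills `v` and the first does not, so the second is a multiple of the first; hence so is `e`. -/
lemma exists_mul_eq (h : IsTop e v) {a : R} (ha : a * e = a) (hav : a • v ≠ 0) :
    ∃ b, e * b = b ∧ b * a = e := by
  obtain ⟨t, ht⟩ := IsSimpleModule.toSpanSingleton_surjective R hav v
  replace ht : t • a • v = v := ht
  have key : ∃ r, e = r * (e * t * a) := by
    rcases h.uniserial (e - e * t * a) (e * t * a) (by rw [sub_mul, h.idem, mul_assoc _ a, ha])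
      (by rw [mul_assoc _ a, ha]) with ⟨r, hr⟩ | ⟨r, hr⟩
    · exact ⟨1 + r, by rw [add_mul, ← hr]; simp⟩
    · exfalso
      have h1 : (e * t * a) • v = v := by rw [mul_smul, mul_smul, ht, h.smul_eq]
      have h2 : (e - e * t * a) • v = 0 := by rw [sub_smul, h1, h.smul_eq, sub_self]
      refine h.ne_zero ?_
      rw [← h1, hr, mul_smul, h2, smul_zero]
  obtain ⟨r, hr⟩ := key
  refine ⟨e * (r * (e * t)), by rw [← mul_assoc, h.idem], ?_⟩
  rw [mul_assoc, mul_assoc r, ← hr, h.idem]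

/-- The one-sided inverse `c` makes `a c` an idempotent. It and its complement in `e` are comparable
by uniseriality, so one of them is zero, and it is not `a c`. -/
lemma exists_inverse (h : IsTop e v) {a : R} (hea : e * a = a) (ha : a * e = a) (hav : a • v ≠ 0) :
    ∃ b, b * a = e ∧ a * b = e := by
  obtain ⟨b, heb, hb⟩ := h.exists_mul_eq ha hav
  have hba : (b * e) * a = e := by rw [mul_assoc, hea, hb]
  set c := b * e with hc
  have hce : c * e = c := by rw [hc, mul_assoc, h.idem]
  have hec : e * c = c := by rw [hc, ← mul_assoc, heb]
  have hpp : (a * c) * (a * c) = a * c := by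
    rw [mul_assoc, ← mul_assoc c, hba, hec]
  have hep : e * (a * c) = a * c := by rw [← mul_assoc, hea]
  have hpe : (a * c) * e = a * c := by rw [mul_assoc, hce]
  refine ⟨c, hba, ?_⟩
  rcases h.uniserial (e - a * c) (a * c) (by rw [sub_mul, h.idem, hpe]) hpe with ⟨r, hr⟩ | ⟨r, hr⟩
  · have h1 : (e - a * c) * (e - a * c) = 0 := by
      conv_lhs => enter [1]; rw [hr]
      rw [mul_sub, mul_assoc, hpe, mul_assoc r, hpp, sub_self]
    rw [sub_mul, mul_sub, mul_sub, h.idem, hep, hpe, hpp, sub_self, sub_zero, sub_eq_zero] at h1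
    exact h1.symm
  · exfalso
    have h1 : a * c = 0 := by
      rw [← hpp]
      conv_lhs => enter [1]; rw [hr]
      rw [mul_assoc, sub_mul, hep, hpp, sub_self, mul_zero]
    refine h.ne_zero ?_
    rw [← h.smul_eq, ← h.idem, ← hba, mul_assoc, ← mul_assoc a, h1]
    simp

end IsTop

lemma IsTop.smul_eq_zero_of_smul_eq_zero {S : Type*} [AddCommGroup S] [Module R S] {e : R} {v : S}
    {S' : Type*} [AddCommGroup S'] [Module R S']
    [IsSimpleModule R S'] (h : IsTop e v) {w : S'} (hw : e • w = w) (hw0 : w ≠ 0) {r : R}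
    (hr : r • v = 0) : r • w = 0 := by
  by_contra h0
  obtain ⟨b, -, hb⟩ := (h.of_smul_eq hw hw0).exists_mul_eq (a := r * e)
    (by rw [mul_assoc, h.idem]) (by rwa [mul_smul, hw])
  refine h.ne_zero ?_
  rw [← h.smul_eq, ← hb, mul_smul, mul_smul, h.smul_eq, hr, smul_zero]

lemma IsTop.nonempty_linearEquiv {S : Type*} [AddCommGroup S] [Module R S] [IsSimpleModule R S]
    {e : R} {v : S} {S' : Type*} [AddCommGroup S'] [Module R S'] [IsSimpleModule R S']
    (h : IsTop e v) {w : S'} (hw : e • w = w) (hw0 : w ≠ 0) : Nonempty (S ≃ₗ[R] S') := by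
  have hker : LinearMap.ker (LinearMap.toSpanSingleton R S v) =
      LinearMap.ker (LinearMap.toSpanSingleton R S' w) := by
    ext r
    exact ⟨h.smul_eq_zero_of_smul_eq_zero hw hw0,
      (h.of_smul_eq hw hw0).smul_eq_zero_of_smul_eq_zero h.smul_eq h.ne_zero⟩
  exact ⟨(LinearMap.quotKerEquivOfSurjective _
    (IsSimpleModule.toSpanSingleton_surjective R h.ne_zero)).symm.trans
    ((Submodule.quotEquivOfEq _ _ hker).trans (LinearMap.quotKerEquivOfSurjective _
    (IsSimpleModule.toSpanSingleton_surjective R hw0)))⟩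

/-- If `a` avoided a maximal left ideal `I`, it would act nontrivially on the image of `e` in `R ⧸
I`. It would then have a left inverse relative to `e`, so it could not kill `v`. -/
lemma IsTop.mem_jacobson {S : Type*} [AddCommGroup S] [Module R S] {e : R} {v : S}
    (h : IsTop e v) {a : R} (ha : a * e = a) (hav : a • v = 0) :
    a ∈ Ring.jacobson R := by
  rw [Ring.jacobson_eq_sInf_isMaximal, Submodule.mem_sInf]
  intro I hI
  have : IsSimpleModule R (R ⧸ I) := isSimpleModule_iff_isCoatom.2 (Ideal.isMaximal_def.1 hI)
  by_contra haI
  have h1 : a • (e • (Submodule.Quotient.mk 1 : R ⧸ I)) ≠ 0 := by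
    rw [← mul_smul, ha, ← Submodule.Quotient.mk_smul, smul_eq_mul, mul_one, Ne,
      Submodule.Quotient.mk_eq_zero]
    exact haI
  obtain ⟨b, -, hb⟩ := (h.of_smul_eq (w := e • (Submodule.Quotient.mk 1 : R ⧸ I))
    (by rw [← mul_smul, h.idem]) (fun h0 => h1 (by rw [h0, smul_zero]))).exists_mul_eq ha h1
  refine h.ne_zero ?_
  rw [← h.smul_eq, ← hb, mul_smul, hav, smul_zero]

end Idempotents

/-! ### From tops and arrows to a Nakayama system. -/

section Construction

variable {R : Type u} [Ring R] {V : Type w} {e : V → R}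

/-- A proper left ideal containing all `e x * r'` would lie in a maximal one, and the `e x` would
kill the corresponding simple quotient. -/
lemma generate_of_tops (H : ∀ (S : Type u) [AddCommGroup S] [Module R S], IsSimpleModule R S →
      ∃ (x : V) (w : S), e x • w ≠ 0) :
    (1 : R) ∈ AddSubgroup.closure {a | ∃ x r r', a = r * e x * r'} := by
  set I := Submodule.span R {a | ∃ x r', a = e x * r'} with hI
  have htop : I = ⊤ := by
    by_contra hne
    obtain ⟨I', hI', hle⟩ := Ideal.exists_le_maximal I hne
    have : IsSimpleModule R (R ⧸ I') := isSimpleModule_iff_isCoatom.2 (Ideal.isMaximal_def.1 hI')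
    obtain ⟨x, w, hw⟩ := H (R ⧸ I') this
    obtain ⟨r, rfl⟩ := Submodule.Quotient.mk_surjective _ w
    rw [← Submodule.Quotient.mk_smul] at hw
    refine hw ((Submodule.Quotient.mk_eq_zero I').2 (hle ?_))
    exact Submodule.subset_span ⟨x, r, rfl⟩
  have key : ∀ a ∈ I, ∀ r, r * a ∈ AddSubgroup.closure {a | ∃ x r r', a = r * e x * r'} := by
    intro a ha
    induction ha using Submodule.span_induction with
    | mem a ha =>
      obtain ⟨x, r', rfl⟩ := ha
      exact fun r => AddSubgroup.subset_closure ⟨x, r, r', by rw [mul_assoc]⟩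
    | zero => simp
    | add a b _ _ ha hb => exact fun r => by rw [mul_add]; exact AddSubgroup.add_mem _ (ha r) (hb r)
    | smul s a _ ha => exact fun r => by rw [smul_eq_mul, ← mul_assoc]; exact ha _
  simpa using key 1 (htop ▸ Submodule.mem_top) 1

/-- The radical of a uniserial projective module is generated by an arrow. -/
lemma exists_arrow [IsNoetherianRing R] (he : ∀ x, e x * e x = e x)
    (hgen : (1 : R) ∈ AddSubgroup.closure {a | ∃ x r r', a = r * e x * r'})
    {S : Type*} [AddCommGroup S] [Module R S] {e₀ : R} {v : S} (h : IsTop e₀ v)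
    (hne : ∃ a ∈ Ring.jacobson R, a * e₀ = a ∧ a ≠ 0) :
    ∃ y α, α ∈ Ring.jacobson R ∧ e y * α = α ∧ α * e₀ = α ∧ α ≠ 0 ∧
      ∀ a ∈ Ring.jacobson R, a * e₀ = a → ∃ r, a = r * α := by
  have hhom : ∃ y α, α ∈ Ring.jacobson R ∧ e y * α = α ∧ α * e₀ = α ∧ α ≠ 0 := by
    by_contra! H
    obtain ⟨a, ha, hae, ha0⟩ := hne
    refine ha0 ((Submodule.mem_bot R).1 (mem_of_forall_idempotent_smul_mem hgen fun x r => ?_))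
    refine (Submodule.mem_bot R).2 (H x _ (Submodule.smul_mem _ _ (Submodule.smul_mem _ _ ha)) ?_ ?_)
    · rw [smul_eq_mul, ← mul_assoc, he]
    · simp only [smul_eq_mul, mul_assoc, hae]
  obtain ⟨y0, α0, hα0⟩ := hhom
  -- The arrow is a homogeneous radical element generating a maximal left ideal; uniseriality
  -- compares all others with it.
  obtain ⟨_, ⟨y, α, ⟨hJ, hy, hx, h0⟩, rfl⟩, hmax⟩ := (wellFounded_gt (α := Submodule R R)).has_min
    {I | ∃ y α, (α ∈ Ring.jacobson R ∧ e y * α = α ∧ α * e₀ = α ∧ α ≠ 0) ∧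
      I = Submodule.span R {α}} ⟨_, y0, α0, hα0, rfl⟩
  refine ⟨y, α, hJ, hy, hx, h0, fun a ha hae => ?_⟩
  suffices a ∈ Submodule.span R {α} by
    obtain ⟨r, hr⟩ := Submodule.mem_span_singleton.1 this
    exact ⟨r, hr.symm⟩
  refine mem_of_forall_idempotent_smul_mem hgen fun z r => ?_
  set b := e z • r • a with hb
  have hbJ : b ∈ Ring.jacobson R := Submodule.smul_mem _ _ (Submodule.smul_mem _ _ ha)
  have hzb : e z * b = b := by rw [hb, smul_eq_mul, ← mul_assoc, he]
  have hbe : b * e₀ = b := by simp only [hb, smul_eq_mul, mul_assoc, hae]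
  by_cases hb0 : b = 0
  · rw [hb0]; exact Submodule.zero_mem _
  rcases h.uniserial b α hbe hx with ⟨s, hs⟩ | ⟨s, hs⟩
  · exact Submodule.mem_span_singleton.2 ⟨s, hs.symm⟩
  · have hle : Submodule.span R {α} ≤ Submodule.span R {b} :=
      (Submodule.span_singleton_le_iff_mem _ _).2 (Submodule.mem_span_singleton.2 ⟨s, hs.symm⟩)
    have hnot := hmax _ ⟨z, b, ⟨hbJ, hzb, hbe, hb0⟩, rfl⟩
    rw [hle.eq_of_not_lt hnot]
    exact Submodule.mem_span_singleton_self b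

lemma isNilpotent_of_mem_jacobson [IsArtinianRing R] {a : R} (ha : a ∈ Ring.jacobson R) :
    IsNilpotent a := by
  obtain ⟨n, hn⟩ := IsSemiprimaryRing.isNilpotent (R := R)
  refine ⟨n, ?_⟩
  have := Ideal.pow_mem_pow ha n
  rw [hn] at this
  simpa using this

lemma arrowPath_mem_jacobson_pow {α : V → R} {σ : Equiv.Perm V}
    (hα : ∀ x, α x ∈ Ring.jacobson R) (n : ℕ) (x : V) :
    arrowPath e α σ n x ∈ Ring.jacobson R ^ n := by
  induction n generalizing x with
  | zero => rw [Submodule.pow_zero, Ideal.one_eq_top]; trivial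
  | succ n ih => rw [arrowPath, Submodule.pow_succ]; exact Ideal.mul_mem_mul (ih _) (hα x)

lemma mul_or_mul_of_op_indecomposable (hR : ProjectivesUniserial Rᵐᵒᵖ) {f : R} (hf : f * f = f)
    (hf0 : f ≠ 0) (H : ∀ g : R, g * g = g → f * g = g → g * f = g → g = 0 ∨ g = f) {a b : R}
    (ha : f * a = a) (hb : f * b = b) : (∃ r, a = b * r) ∨ ∃ r, b = a * r := by
  have hff : op f * op f = op f := by rw [← op_mul, hf]
  have := projective_span hff
  have huni := hR (Submodule.span Rᵐᵒᵖ {op f}) inferInstance this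
    (isIndecomposable_span hff (by simpa using hf0) fun g h1 h2 h3 => by
      induction g using MulOpposite.rec' with | _ g
      rw [← op_mul, op_inj] at h1 h2 h3
      rw [op_eq_zero_iff, op_inj]
      exact H g h1 h3 h2)
  rcases huni.eq_mul_or (a := op a) (b := op b) (by rw [← op_mul, ha]) (by rw [← op_mul, hb]) with
    ⟨r, hr⟩ | ⟨r, hr⟩
  · exact Or.inl ⟨unop r, op_injective (by simp [hr])⟩
  · exact Or.inr ⟨unop r, op_injective (by simp [hr])⟩

/-- Tops of indecomposable projective modules and arrows make up a Nakayama system. -/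
lemma exists_system_of_tops [IsArtinianRing R] [Finite V] (hR : ProjectivesUniserial Rᵐᵒᵖ)
    {S : V → Type u} [∀ x, AddCommGroup (S x)] [∀ x, Module R (S x)]
    [∀ x, IsSimpleModule R (S x)] {v : ∀ x, S x} (h : ∀ x, IsTop (e x) (v x))
    (hS : ∀ x y, Nonempty (S x ≃ₗ[R] S y) → x = y)
    (hgen : (1 : R) ∈ AddSubgroup.closure {a | ∃ x r r', a = r * e x * r'})
    (hne : ∀ x, ∃ a ∈ Ring.jacobson R, a * e x = a ∧ a ≠ 0) :
    ∃ D : NakayamaSystem R V, D.e = e := by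
  -- Homogeneous elements are either invertible between equal vertices or radical.
  have halt : ∀ x y a, e y * a = a → a * e x = a →
      (x = y ∧ ∃ b, b * a = e x ∧ a * b = e y) ∨ a ∈ Ring.jacobson R := by
    intro x y a hy hx
    by_cases hav : a • v x = 0
    · exact Or.inr ((h x).mem_jacobson hx hav)
    · left
      have hyx : y = x := hS y x ((h y).nonempty_linearEquiv (w := a • v x)
        (by rw [← mul_smul, hy]) hav)
      subst hyx
      exact ⟨rfl, (h y).exists_inverse hy hx hav⟩
  have he0 : ∀ x, e x ≠ 0 := fun x h0 => (h x).ne_zero (by rw [← (h x).smul_eq, h0, zero_smul])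
  have hunits : ∀ x b, b * e x ∈ Ring.jacobson R → b * e x ≠ e x := fun x b hb hb' =>
    he0 x (NakayamaSystem.eq_zero_of_mul_eq_self (isNilpotent_of_mem_jacobson hb)
      (by rw [hb', (h x).idem]))
  have hright : ∀ y a b, e y * a = a → e y * b = b → (∃ r, a = b * r) ∨ ∃ r, b = a * r := by
    intro y a b ha hb
    refine mul_or_mul_of_op_indecomposable hR (h y).idem (he0 y) (fun g h1 h2 h3 => ?_) ha hb
    rcases halt y y g h2 h3 with ⟨-, b, hb, hb'⟩ | hg
    · right
      rw [← hb, ← h1, ← mul_assoc, hb, h1, h2]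
    · left
      exact NakayamaSystem.eq_zero_of_mul_eq_self (isNilpotent_of_mem_jacobson hg) h1
  choose s α hJ hl hr hα0 hgenα using fun x =>
    exists_arrow (fun x => (h x).idem) hgen (h x) (hne x)
  -- An arrow does not factor through two radical elements. This irreducibility forces the
  -- connecting factors below to be invertible.
  have hzero : ∀ x a t, a ∈ Ring.jacobson R → t ∈ Ring.jacobson R → t * e x = t →
      α x ≠ a * t := by
    intro x a t ha ht hte h0
    obtain ⟨q, hq⟩ := hgenα x t ht hte
    refine hα0 x (NakayamaSystem.eq_zero_of_mul_eq_self'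
      (isNilpotent_of_mem_jacobson ((Ring.jacobson R).mul_mem_right q ha)) ?_)
    rw [mul_assoc, ← hq, ← h0]
  -- Two arrows with the same end are comparable on the right, as the right projective there is
  -- uniserial. The factor relating them cannot be radical, so their starting points agree.
  have hinj : Function.Injective s := by
    have key : ∀ x x', s x = s x' → (∃ r, α x = α x' * r) → x = x' := by
      rintro x x' hss ⟨r, hr'⟩
      have h1 : α x = α x' * (e x' * r * e x) := by
        rw [mul_assoc, ← mul_assoc, hr, ← mul_assoc, ← hr', hr]
      rcases halt x x' (e x' * r * e x) (by simp only [← mul_assoc, (h _).idem])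
        (by simp only [mul_assoc, (h _).idem]) with ⟨h2, -⟩ | h2
      · exact h2
      · exact absurd h1 (hzero x _ _ (hJ x') h2 (by simp only [mul_assoc, (h _).idem]))
    intro x x' hss
    rcases hright (s x) (α x) (α x') (hl x) (by rw [hss, hl]) with hh | hh
    · exact key x x' hss hh
    · exact (key x' x hss.symm hh).symm
  let σ : Equiv.Perm V := Equiv.ofBijective s hinj.bijective_of_finite
  have hσ : ∀ y, s (σ.symm y) = y := fun y => σ.apply_symm_apply y
  refine ⟨⟨e, α, σ, fun x => (h x).idem, he0, hl, hr, fun x y a hy hx => ?_, fun x t => ?_, ?_,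
    hgen⟩, rfl⟩
  · rcases halt x y a hy hx with h1 | haJ
    · exact Or.inl h1
    refine Or.inr ⟨hgenα x a haJ hx, ?_⟩
    set z := σ.symm y with hz
    have hzl : e y * α z = α z := by
      have := hl z
      rwa [hz, hσ y] at this
    rcases hright y a (α z) hy hzl with h1 | ⟨r, hr'⟩
    · exact h1
    have h1 : α z = a * (e x * r * e z) := by
      rw [mul_assoc, ← mul_assoc, hx, ← mul_assoc, ← hr', hr]
    rcases halt z x (e x * r * e z) (by simp only [← mul_assoc, (h _).idem])
        (by simp only [mul_assoc, (h _).idem]) with ⟨-, b, -, hb⟩ | h2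
    · refine ⟨b, ?_⟩
      rw [h1, mul_assoc, hb, hx]
    · exact absurd h1 (hzero z _ _ haJ h2 (by simp only [mul_assoc, (h _).idem]))
  · exact isNilpotent_of_mem_jacobson (Submodule.smul_mem _ t (hJ x))
  · obtain ⟨n, hn⟩ := IsSemiprimaryRing.isNilpotent (R := R)
    refine ⟨n, fun x => ?_⟩
    have := arrowPath_mem_jacobson_pow (e := e) (σ := σ) hJ n x
    rw [hn] at this
    simpa using this

end Construction

/-! ### Comparison of `len` with the module length. -/

section Length

variable {R : Type u} [Ring R] {V : Type w} (D : NakayamaSystem R V)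

/-- A submodule of `P(x)` is governed by its level, so `len x - level` is strictly monotone and
bounds the height of the submodule lattice. -/
lemma NakayamaSystem.length_le (x : V) :
    Module.length R (Submodule.span R {D.e x}) ≤ D.len x := by
  choose lev hlev hiff using fun N : Submodule R (Submodule.span R {D.e x}) =>
    D.exists_level N x (D.pathGen 0 x)
  have hm : D.e x • D.pathGen 0 x = D.pathGen 0 x := Subtype.ext (D.idem x)
  have hmono : StrictMono fun N => D.len x - lev N := by
    intro N N' hlt
    have h1 := hlev N
    suffices lev N' < lev N by dsimp only; omega
    by_contra! hle
    refine hlt.not_ge fun q hq => ?_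
    obtain ⟨r, hr⟩ := q
    have hre : r • D.pathGen 0 x = ⟨r, hr⟩ := Subtype.ext (mul_eq_of_mem_span (D.idem x) hr)
    have hq' : r • D.pathGen 0 x ∈ N' := hre ▸ hq
    suffices h : r • D.pathGen 0 x ∈ N from hre ▸ h
    obtain ⟨t, ht⟩ := Submodule.mem_span_singleton.1
      (D.mem_span_path hm (fun k => (hiff N' k).1) hq')
    have : r • D.pathGen 0 x = t • D.path (lev N') x • D.pathGen 0 x := by
      rw [← mul_smul, ← smul_eq_mul, ht, mul_smul, hm]
    rw [this]
    exact N.smul_mem _ ((hiff N _).2 hle)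
  rw [Module.length_eq_height]
  refine (Order.height_le_height_apply_of_strictMono _ hmono ⊤).trans ?_
  simp

end Length

section Covers

variable {R : Type u} [Ring R]

lemma exists_linearEquiv_of_projectiveCovers {P Q M : Type*} [AddCommGroup P] [Module R P]
    [AddCommGroup Q] [Module R Q] [AddCommGroup M] [Module R M] {π : P →ₗ[R] M} {p : Q →ₗ[R] M}
    (hπ : IsProjectiveCover R π) (hp : IsProjectiveCover R p) :
    ∃ f : P ≃ₗ[R] Q, p ∘ₗ f = π := by
  obtain ⟨hP, hπs, hπ⟩ := hπ
  obtain ⟨hQ, hps, hp⟩ := hp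
  obtain ⟨f, hf⟩ := Module.projective_lifting_property p π hps
  have hfs : Function.Surjective f := by
    rw [← LinearMap.range_eq_top]
    refine hp _ (eq_top_iff.2 fun q _ => ?_)
    obtain ⟨x, hx⟩ := hπs (p q)
    refine Submodule.mem_sup.2 ⟨f x, ⟨x, rfl⟩, q - f x, ?_, by abel⟩
    rw [LinearMap.mem_ker, map_sub, ← hx, ← hf, LinearMap.comp_apply, sub_self]
  obtain ⟨g, hg⟩ := Module.projective_lifting_property f LinearMap.id hfs
  have hfg : ∀ q, f (g q) = q := fun q => LinearMap.congr_fun hg q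
  have hgs : Function.Surjective g := by
    rw [← LinearMap.range_eq_top]
    refine hπ _ (eq_top_iff.2 fun x _ => ?_)
    refine Submodule.mem_sup.2 ⟨g (f x), ⟨f x, rfl⟩, x - g (f x), ?_, by abel⟩
    rw [LinearMap.mem_ker, map_sub, ← hf, LinearMap.comp_apply, LinearMap.comp_apply, hfg, sub_self]
  have hfi : Function.Injective f := by
    intro x y hxy
    obtain ⟨x, rfl⟩ := hgs x
    obtain ⟨y, rfl⟩ := hgs y
    rw [hfg, hfg] at hxy
    rw [hxy]
  exact ⟨LinearEquiv.ofBijective f ⟨hfi, hfs⟩, hf⟩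

end Covers

/-! ### Projective covers, socles and the projective dimension of simple modules. -/

namespace NakayamaSystem

variable {R : Type u} [Ring R] {V : Type w} (D : NakayamaSystem R V)

section

variable {M : Type*} [AddCommGroup M] [Module R M] {x : V} {l : ℕ} {m : M}

/-- Only a complement of the radical can generate `P(x)`. -/
lemma e_mem_or_of_add_eq {N N' : Submodule R (Submodule.span R {D.path 0 x})}
    (h : N ⊔ N' = ⊤) : N = ⊤ ∨ N' = ⊤ := by
  have hs : D.pathGen 0 x ∈ N ⊔ N' := by rw [h]; trivial
  obtain ⟨a, ha, b, hb, hab⟩ := Submodule.mem_sup.1 hs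
  have key : ∀ (N : Submodule R (Submodule.span R {D.path 0 x})) (a : Submodule.span R {D.path 0 x}),
      a ∈ N → N = ⊤ ∨ ∃ r, D.e x * a = r * D.α x := by
    intro N a ha
    rcases D.unit_or_arrow x x (D.e x * a) (by rw [← mul_assoc, D.idem])
      (by rw [mul_assoc, D.mem_span_e_iff.1 a.2]) with ⟨-, c, hc, -⟩ | ⟨h, -⟩
    · left
      have : D.pathGen 0 x = (c * D.e x) • a := Subtype.ext (by
        rw [← mul_assoc] at hc; exact hc.symm)
      exact eq_top_of_spanGen_mem (e := D.path 0 x) (by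
        change D.pathGen 0 x ∈ N
        rw [this]
        exact N.smul_mem _ ha)
    · exact Or.inr h
  rcases key N a ha with h1 | ⟨r, hr⟩
  · exact Or.inl h1
  rcases key N' b hb with h2 | ⟨s, hs⟩
  · exact Or.inr h2
  exfalso
  have hab' : (a : R) + b = D.e x := congrArg Subtype.val hab
  have : D.e x * ((r + s) * D.α x) = D.e x := by
    rw [add_mul, ← hr, ← hs, ← mul_add, hab', D.idem, D.idem]
  exact D.e_ne_zero x (eq_zero_of_mul_eq_self (D.nilpotent x _) this)

lemma isProjectiveCover_fromProj (h : D.IsGenerator x l m) (hl : 0 < l) :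
    IsProjectiveCover R (D.fromProj x m) := by
  refine ⟨inferInstance, D.fromProj_surjective h.e_smul h.span_eq_top, fun N hN => ?_⟩
  refine (D.e_mem_or_of_add_eq hN).resolve_right fun hker => ?_
  have h0 : D.fromProj x m (D.pathGen 0 x) = 0 := by
    rw [← LinearMap.mem_ker, hker]; trivial
  have h1 : D.path 0 x • m = 0 := h0
  rw [h.path_smul_eq_zero_iff] at h1
  omega

variable {D}

lemma IsGenerator.ne_zero (h : D.IsGenerator x l m) (hl : 0 < l) : m ≠ 0 := by
  have := (h.path_smul_eq_zero_iff 0).not.2 (by omega)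
  rwa [path_zero, h.e_smul] at this

/-- An element of a submodule of a uniserial module is a multiple of a path. -/
lemma IsGenerator.exists_eq_smul_path (h : D.IsGenerator x l m) {N : Submodule R M} {n : ℕ}
    (hn : ∀ k, D.path k x • m ∈ N → n ≤ k) {y : M} (hy : y ∈ N) :
    ∃ t : R, y = t • D.path n x • m := by
  obtain ⟨r, rfl⟩ := Submodule.mem_span_singleton.1
    (h.span_eq_top ▸ Submodule.mem_top : y ∈ Submodule.span R {m})
  obtain ⟨t, ht⟩ := Submodule.mem_span_singleton.1 (D.mem_span_path h.e_smul hn hy)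
  exact ⟨t, by rw [← mul_smul, ← smul_eq_mul, ht, mul_smul, h.e_smul]⟩

lemma IsGenerator.isSimpleModule (h : D.IsGenerator x 1 m) : IsSimpleModule R M := by
  rw [isSimpleModule_iff_toSpanSingleton_surjective]
  refine ⟨⟨m, 0, h.ne_zero one_pos⟩, fun y hy z => ?_⟩
  obtain ⟨n, -, hn⟩ := D.exists_level (Submodule.span R {y}) x m
  obtain ⟨t, ht⟩ := h.exists_eq_smul_path (fun k => (hn k).1) (Submodule.mem_span_singleton_self y)
  have hn0 : n = 0 := by
    by_contra h0
    refine hy ?_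
    rw [ht, (h.path_smul_eq_zero_iff n).2 (by omega), smul_zero]
  have hm := (hn 0).2 hn0.le
  rw [path_zero, h.e_smul] at hm
  have hz : z ∈ Submodule.span R {y} := by
    have : Submodule.span R {m} ≤ Submodule.span R {y} :=
      (Submodule.span_singleton_le_iff_mem _ _).2 hm
    rw [h.span_eq_top] at this
    exact this trivial
  exact Submodule.mem_span_singleton.1 hz

lemma IsGenerator.isGenerator_of_span_eq (h : D.IsGenerator x (l + 1) m) {N : Submodule R M}
    (hN : N = Submodule.span R {D.path l x • m}) :
    D.IsGenerator ((D.σ ^ l) x) 1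
      (⟨D.path l x • m, hN ▸ Submodule.mem_span_singleton_self _⟩ : N) where
  e_smul := Subtype.ext (by
    change D.e _ • D.path l x • m = _
    rw [← mul_smul, e_mul_path])
  span_eq_top := by
    subst hN
    rw [eq_top_iff]
    rintro ⟨r, hr⟩ -
    obtain ⟨t, rfl⟩ := Submodule.mem_span_singleton.1 hr
    exact Submodule.mem_span_singleton.2 ⟨t, rfl⟩
  path_smul_eq_zero_iff n := by
    rw [← Subtype.coe_inj]
    change D.path n _ • D.path l x • m = 0 ↔ _
    rw [← mul_smul, ← path_add, h.path_smul_eq_zero_iff]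
    omega

/-- The socle of the uniserial module with generator `m`. -/
lemma IsGenerator.socle_eq (h : D.IsGenerator x (l + 1) m) :
    socle R M = Submodule.span R {D.path l x • m} := by
  have hsimple : IsSimpleModule R (Submodule.span R {D.path l x • m}) :=
    (h.isGenerator_of_span_eq rfl).isSimpleModule
  refine le_antisymm (sSup_le fun N hN => ?_) (le_sSup hsimple)
  have hN' : IsSimpleModule R N := hN
  obtain ⟨n, -, hn⟩ := D.exists_level N x m
  have hle : Submodule.span R {D.path l x • m} ≤ N := by
    rw [Submodule.span_singleton_le_iff_mem, hn]
    by_contra! hlt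
    have := IsSimpleModule.nontrivial R N
    obtain ⟨⟨y, hy⟩, hy0⟩ := exists_ne (0 : N)
    obtain ⟨t, ht⟩ := h.exists_eq_smul_path (fun k => (hn k).1) hy
    rw [(h.path_smul_eq_zero_iff n).2 (by omega), smul_zero] at ht
    exact hy0 (Subtype.ext ht)
  exact ((isSimpleModule_iff_isAtom.1 hN').le_iff.1 hle).elim
    (fun h0 => absurd h0 (isSimpleModule_iff_isAtom.1 hsimple).1) fun h => h.ge

lemma isGenerator_of_isTop [IsSimpleModule R M] (h : IsTop (D.e x) m) : D.IsGenerator x 1 m where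
  e_smul := h.smul_eq
  span_eq_top := IsSimpleModule.span_singleton_eq_top R h.ne_zero
  path_smul_eq_zero_iff n := by
    constructor
    · intro h0
      by_contra hn
      obtain rfl : n = 0 := by omega
      rw [path_zero, h.smul_eq] at h0
      exact h.ne_zero h0
    · intro hn
      obtain ⟨k, rfl⟩ := Nat.exists_eq_add_of_le' hn
      rw [path_succ, mul_smul]
      suffices D.α x • m = 0 by rw [this, smul_zero]
      by_contra h0
      obtain ⟨b, -, hb⟩ := h.exists_mul_eq (D.α_mul_e x) h0
      exact D.e_ne_zero x (eq_zero_of_mul_eq_self (D.nilpotent x b) (by rw [hb, D.idem]))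

variable (D)

/-- The radical of `P(x)` is projective if and only if `x` is not black. -/
lemma projective_span_path_one_iff (hx : 1 < D.len x) :
    Module.Projective R (Submodule.span R {D.path 1 x}) ↔ ¬ D.Black x := by
  have hgen : D.IsGenerator (D.σ x) (D.len x - 1) (D.pathGen 1 x) := D.isGenerator_pathGen hx.le
  have hsurj := D.fromProj_surjective hgen.e_smul hgen.span_eq_top
  constructor
  · intro hproj hb
    obtain ⟨s, hs⟩ := Module.projective_lifting_property (D.fromProj (D.σ x) (D.pathGen 1 x))
      LinearMap.id hsurj
    -- `a` is the image of the generator under a splitting. It satisfies `a * α x = α x`, so it is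
    -- not in the radical; it is killed by a path that is nonzero when `x` is black, so it is not
    -- invertible either.
    set a : R := (s (D.pathGen 1 x)).val with ha
    have hea : D.e (D.σ x) * a = a := by
      have := map_smul s (D.e (D.σ x)) (D.pathGen 1 x)
      rw [hgen.e_smul] at this
      exact (congrArg Subtype.val this).symm
    have hpa : D.path (D.len x - 1) (D.σ x) * a = 0 := by
      have := map_smul s (D.path (D.len x - 1) (D.σ x)) (D.pathGen 1 x)
      rw [(hgen.path_smul_eq_zero_iff _).2 le_rfl, map_zero] at this
      exact (congrArg Subtype.val this).symm
    have haα : a * D.α x = D.α x := by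
      have : (D.fromProj (D.σ x) (D.pathGen 1 x)) (s (D.pathGen 1 x)) = D.pathGen 1 x :=
        LinearMap.congr_fun hs _
      have := congrArg Subtype.val this
      change a * D.path 1 x = D.path 1 x at this
      rwa [path_one] at this
    rcases D.unit_or_arrow (D.σ x) (D.σ x) a hea (D.mem_span_e_iff.1 (s (D.pathGen 1 x)).2) with
      ⟨-, b, -, hb'⟩ | ⟨⟨r, hr⟩, -⟩
    · have h0 : D.path (D.len x - 1) (D.σ x) = 0 := by
        rw [← path_mul_e, ← hb', ← mul_assoc, hpa, zero_mul]
      rw [path_eq_zero_iff] at h0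
      have : D.len x ≤ D.len (D.σ x) := hb
      omega
    · have h0 := eq_zero_of_mul_eq_self' (D.nilpotent (D.σ x) r) (hr ▸ haα)
      rw [← path_one, path_eq_zero_iff] at h0
      omega
  · intro hb
    refine Module.Projective.of_equiv (LinearEquiv.ofBijective _ ⟨?_, hsurj⟩)
    rw [← LinearMap.ker_eq_bot, Submodule.eq_bot_iff]
    rintro ⟨r, hr⟩ h0
    refine Subtype.ext (D.mul_α_eq_zero hb (D.mem_span_e_iff.1 hr) ?_)
    have := congrArg Subtype.val (LinearMap.mem_ker.1 h0)
    change r * D.path 1 x = 0 at this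
    rwa [path_one] at this

/-- The first syzygy of the simple module is `rad P(x)`, so the projectivity of that radical
decides. The bound on `len x` matters: for length one the radical is zero, yet the inequality
defining `Black` holds. -/
lemma two_le_projectiveDimension_iff {M : ModuleCat.{u} R} {m : M} (h : D.IsGenerator x 1 m)
    (hx : 1 < D.len x) : 2 ≤ projectiveDimension M ↔ D.Black x := by
  rw [← not_iff_not, ← D.projective_span_path_one_iff hx]
  have h1 := projectiveDimension_ge_iff M 2
  rw [Nat.cast_ofNat] at h1
  rw [h1, not_not,
    (D.syzygyComplex_shortExact h).hasProjectiveDimensionLT_X₃_iff 0 inferInstance, zero_add,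
    ← projective_iff_hasProjectiveDimensionLT_one]
  exact (IsProjective.iff_projective (R := R) (Submodule.span R {D.path 1 x})).symm

end

end NakayamaSystem

/-! ### The socle of the injective hull of `k / rad k`. -/

section InjectiveHull

variable {k : Type v} [CommRing k] {J : Type v} [AddCommGroup J] [Module k J]

lemma mem_ring_jacobson_iff {c : k} :
    c ∈ Ring.jacobson k ↔ ∀ m : Ideal k, m.IsMaximal → c ∈ m := by
  rw [Ring.jacobson_eq_sInf_isMaximal, Submodule.mem_sInf]
  rfl

lemma exists_mem_maximal_ne [IsArtinianRing k] (m : Ideal k) [hm : m.IsMaximal] :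
    ∃ a, a ∉ m ∧ ∀ m' : Ideal k, m'.IsMaximal → m' ≠ m → a ∈ m' := by
  classical
  have : Fintype (MaximalSpectrum k) := Fintype.ofFinite _
  let s : Finset (MaximalSpectrum k) := Finset.univ.filter fun m' => m'.asIdeal ≠ m
  have hnot : ¬ s.inf MaximalSpectrum.asIdeal ≤ m := by
    intro h
    obtain ⟨m', hm', hle⟩ := (Ideal.IsPrime.inf_le' hm.isPrime).1 h
    exact (Finset.mem_filter.1 hm').2 (m'.isMaximal.eq_of_le hm.ne_top hle)
  obtain ⟨a, ha, ham⟩ := Set.not_subset.1 hnot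
  refine ⟨a, ham, fun m' h1 h2 => ?_⟩
  have hle : s.inf MaximalSpectrum.asIdeal ≤ m' :=
    Finset.inf_le (f := MaximalSpectrum.asIdeal) (b := ⟨m', h1⟩)
      (Finset.mem_filter.2 ⟨Finset.mem_univ _, h2⟩)
  exact hle ha

/-- The part of the injective hull of `k / rad k` annihilated by a maximal ideal is simple. -/
lemma exists_generator_annihilated [IsArtinianRing k]
    {ι : (k ⧸ Ring.jacobson k) →ₗ[k] J} (hJ : IsInjectiveHull k ι)
    (m : Ideal k) [hm : m.IsMaximal] : ∃ j₀ : J, j₀ ≠ 0 ∧ (∀ c ∈ m, c • j₀ = 0) ∧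
      ∀ j, (∀ c ∈ m, c • j = 0) → ∃ d : k, j = d • j₀ := by
  obtain ⟨-, hinj, hess⟩ := hJ
  obtain ⟨a, ham, ha⟩ := exists_mem_maximal_ne m
  have hι : ∀ b : k, ι (Submodule.Quotient.mk b) = 0 ↔ b ∈ Ring.jacobson k := by
    intro b
    rw [map_eq_zero_iff ι hinj, Submodule.Quotient.mk_eq_zero]
  have hιs : ∀ c b : k, c • ι (Submodule.Quotient.mk b) = ι (Submodule.Quotient.mk (c * b)) := by
    intro c b
    rw [← map_smul, ← Submodule.Quotient.mk_smul, smul_eq_mul]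
  -- As `a` lies in every maximal ideal except `m`, its class spans the `k / m`-part of `k / rad k`.
  refine ⟨ι (Submodule.Quotient.mk a), fun h0 => ?_, fun c hc => ?_, fun j hj => ?_⟩
  · exact ham (mem_ring_jacobson_iff.1 ((hι a).1 h0) m hm)
  · rw [hιs, hι, mem_ring_jacobson_iff]
    intro m' hm'
    by_cases h : m' = m
    · rw [h]; exact m.mul_mem_right _ hc
    · exact m'.mul_mem_left _ (ha m' hm' h)
  · by_cases hj0 : j = 0
    · exact ⟨0, by rw [hj0, zero_smul]⟩
    -- Essentiality puts a nonzero multiple of `j` into the range of `ι`. The multiplier is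
    -- invertible modulo `m`, which kills `j`, so `j` itself is in the range.
    have hne : Submodule.span k {j} ⊓ LinearMap.range ι ≠ ⊥ := fun h => by
      have := hess _ h
      rw [Submodule.span_singleton_eq_bot] at this
      exact hj0 this
    obtain ⟨y, ⟨hy1, ⟨q, hq⟩⟩, hy0⟩ := (Submodule.ne_bot_iff _).1 hne
    obtain ⟨d, rfl⟩ := Submodule.mem_span_singleton.1 hy1
    obtain ⟨b, rfl⟩ := Submodule.Quotient.mk_surjective _ q
    have hdm : d ∉ m := fun h => hy0 (hj d h)
    obtain ⟨d', hd'⟩ := hm.exists_inv hdm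
    obtain ⟨i, hi, hdi⟩ := hd'
    have hjb : j = ι (Submodule.Quotient.mk (d' * b)) := by
      rw [← hιs, hq, ← mul_smul]
      conv_lhs => rw [← one_smul k j, ← hdi, add_smul, hj i hi, add_zero]
    obtain ⟨a', i', hi', hai'⟩ := hm.exists_inv ham
    refine ⟨d' * b * a', ?_⟩
    rw [hjb, hιs, ← sub_eq_zero, ← map_sub, ← Submodule.Quotient.mk_sub, hι]
    have hu : d' * b - d' * b * a' * a = d' * b * i' := by
      linear_combination (-(d' * b)) * hai'
    have h3 : i' * (d' * b) ∈ Ring.jacobson k := by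
      rw [← hι, ← hιs, ← hjb, hj i' hi']
    rw [hu, mul_comm]
    exact h3

lemma IsInjectiveHull.exists_extension {ι : (k ⧸ Ring.jacobson k) →ₗ[k] J}
    (hJ : IsInjectiveHull k ι) {X Y : Type*} [AddCommGroup X] [Module k X] [AddCommGroup Y]
    [Module k Y] (f : X →ₗ[k] Y) (hf : Function.Injective f) (g : X →ₗ[k] J) :
    ∃ h : Y →ₗ[k] J, ∀ x, h (f x) = g x := by
  have hb : Module.Baer k J := Module.Baer.of_injective hJ.1
  obtain ⟨h, hh⟩ := hb.extension_property f hf g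
  exact ⟨h, LinearMap.congr_fun hh⟩

end InjectiveHull

/-! ### Duals of simple right modules. -/

section Dual

variable {k : Type v} [CommRing k] {J : Type v} [AddCommGroup J] [Module k J]
  {Λ : Type u} [Ring Λ] [Algebra k Λ]
  {X : Type u} [AddCommGroup X] [Module Λᵐᵒᵖ X] [Module k X]

/-- Right multiplication by a fixed element, as an endomorphism of the `k`-module `X`. -/
def rightMul (hX : ∀ (c : k) (x : X), c • x = op (algebraMap k Λ c) • x) (a : Λ) : X →ₗ[k] X where
  toFun x := op a • x
  map_add' x y := smul_add _ x y
  map_smul' c x := by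
    rw [hX, hX, RingHom.id_apply, ← mul_smul, ← mul_smul, ← op_mul, ← op_mul, Algebra.commutes]

lemma finite_of_simple (hX : ∀ (c : k) (x : X), c • x = op (algebraMap k Λ c) • x)
    [Module.Finite k Λ] [IsSimpleModule Λᵐᵒᵖ X] : Module.Finite k X := by
  have := IsSimpleModule.nontrivial Λᵐᵒᵖ X
  obtain ⟨x, hx⟩ := exists_ne (0 : X)
  let f : Λ →ₗ[k] X :=
    { toFun := fun a => op a • x
      map_add' := fun a b => by rw [MulOpposite.op_add, add_smul]
      map_smul' := fun c a => by
        rw [hX, RingHom.id_apply, ← mul_smul, ← op_mul, Algebra.smul_def, Algebra.commutes] }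
  refine Module.Finite.of_surjective f fun y => ?_
  obtain ⟨a, ha⟩ := IsSimpleModule.toSpanSingleton_surjective Λᵐᵒᵖ hx y
  exact ⟨unop a, ha⟩

lemma annihilated_of_simple (hX : ∀ (c : k) (x : X), c • x = op (algebraMap k Λ c) • x)
    [IsSimpleModule Λᵐᵒᵖ X] {c : k} {x : X} (hx : x ≠ 0) (h : c • x = 0)
    (y : X) : c • y = 0 := by
  obtain ⟨a, rfl⟩ := IsSimpleModule.toSpanSingleton_surjective Λᵐᵒᵖ hx y
  induction a using MulOpposite.rec' with | _ a
  change c • rightMul hX a x = 0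
  rw [← map_smul, h, map_zero]

lemma isMaximal_annihilator (hX : ∀ (c : k) (x : X), c • x = op (algebraMap k Λ c) • x)
    [IsArtinianRing k] [IsSimpleModule Λᵐᵒᵖ X] : (Module.annihilator k X).IsMaximal := by
  have := IsSimpleModule.nontrivial Λᵐᵒᵖ X
  obtain ⟨x, hx⟩ := exists_ne (0 : X)
  have : (Module.annihilator k X).IsPrime := by
    refine ⟨fun h => hx ?_, fun {c d} hcd => ?_⟩
    · have h1 : (1 : k) ∈ Module.annihilator k X := h ▸ Submodule.mem_top
      simpa using Module.mem_annihilator.1 h1 x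
    · by_cases hd : d • x = 0
      · exact Or.inr (Module.mem_annihilator.2 (annihilated_of_simple hX hx hd))
      · left
        refine Module.mem_annihilator.2 (annihilated_of_simple hX hd ?_)
        rw [← mul_smul]
        exact Module.mem_annihilator.1 hcd x
  exact IsArtinianRing.isMaximal_of_isPrime _

/-- The dual of a simple module is generated by any nonzero element. -/
lemma exists_dual_eq (hX : ∀ (c : k) (x : X), c • x = op (algebraMap k Λ c) • x)
    [IsArtinianRing k] [Module.Finite k Λ] {ι : (k ⧸ Ring.jacobson k) →ₗ[k] J}
    (hJ : IsInjectiveHull k ι) [IsSimpleModule Λᵐᵒᵖ X] {φ : X →ₗ[k] J} (hφ : φ ≠ 0) (ψ : X →ₗ[k] J) :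
    ∃ a : Λ, ∀ x, ψ x = φ (op a • x) := by
  classical
  have hfin := finite_of_simple hX
  have hmax := isMaximal_annihilator hX
  set m := Module.annihilator k X
  obtain ⟨j₀, hj₀, hmj₀, hgen⟩ := exists_generator_annihilated hJ m
  have hval : ∀ (χ : X →ₗ[k] J) x, ∃ d : k, χ x = d • j₀ := fun χ x =>
    hgen _ fun c hc => by rw [← map_smul, Module.mem_annihilator.1 hc, map_zero]
  have hsep : ∀ x : X, x ≠ 0 → ∃ a : Λ, φ (op a • x) ≠ 0 := by
    intro x hx
    by_contra! h
    refine hφ (LinearMap.ext fun y => ?_)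
    obtain ⟨a, rfl⟩ := IsSimpleModule.toSpanSingleton_surjective Λᵐᵒᵖ hx y
    exact h (unop a)
  -- `X` is artinian over `k`, so finitely many translates of `φ` separate its points and embed `X`
  -- in a finite power of `J`.
  obtain ⟨_, ⟨s, rfl⟩, hmin⟩ := (wellFounded_lt (α := Submodule k X)).has_min
    (Set.range fun s : Finset Λ => ⨅ a ∈ s, LinearMap.ker (φ ∘ₗ rightMul hX a)) ⟨_, ∅, rfl⟩
  have hs : ∀ x : X, (∀ a ∈ s, φ (op a • x) = 0) → x = 0 := by
    intro x hx
    by_contra hx0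
    obtain ⟨a, ha⟩ := hsep x hx0
    refine hmin _ ⟨insert a s, rfl⟩ ?_
    beta_reduce
    rw [Finset.iInf_insert]
    refine lt_of_le_of_ne inf_le_right fun h => ha ?_
    have hxs : x ∈ ⨅ a ∈ s, LinearMap.ker (φ ∘ₗ rightMul hX a) := by
      simp only [Submodule.mem_iInf]
      exact hx
    rw [← h] at hxs
    exact hxs.1
  let F : X →ₗ[k] (s → J) := LinearMap.pi fun a => φ ∘ₗ rightMul hX (a : Λ)
  have hF : Function.Injective F := by
    rw [← LinearMap.ker_eq_bot, Submodule.eq_bot_iff]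
    exact fun x hx => hs x fun a ha => congrFun hx ⟨a, ha⟩
  -- `ψ` extends to this power. On each coordinate only multiples of `j₀` occur, where the extension
  -- acts as a scalar; these scalars are the coefficients of `a`.
  obtain ⟨h, hh⟩ := hJ.exists_extension F hF ψ
  have hscal : ∀ a : s, ∃ c : k, h (Pi.single a j₀) = c • j₀ := fun a =>
    hgen _ fun c hc => by rw [← map_smul, ← Pi.single_smul, hmj₀ c hc, Pi.single_zero, map_zero]
  choose c hc using hscal
  refine ⟨∑ a : s, algebraMap k Λ (c a) * a, fun x => ?_⟩
  have h1 : h (F x) = ∑ a : s, h (Pi.single a (F x a)) := by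
    rw [← map_sum, Finset.univ_sum_single]
  have h2 : op (∑ a : s, algebraMap k Λ (c a) * a) • x = ∑ a : s, c a • (op (a : Λ) • x) := by
    rw [Finset.op_sum, Finset.sum_smul]
    refine Finset.sum_congr rfl fun a _ => ?_
    rw [hX, ← mul_smul, ← op_mul, Algebra.commutes]
  rw [← hh, h1, h2, map_sum]
  refine Finset.sum_congr rfl fun a _ => ?_
  obtain ⟨d, hd⟩ := hval (φ ∘ₗ rightMul hX (a : Λ)) x
  change h (Pi.single a ((φ ∘ₗ rightMul hX (a : Λ)) x)) = _
  rw [map_smul, hd, Pi.single_smul, map_smul, hc, smul_comm, ← hd]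
  rfl

/-- The dual of a simple right module is the simple left module with the same idempotent. -/
lemma isDual_of_simple (hX : ∀ (c : k) (x : X), c • x = op (algebraMap k Λ c) • x)
    [IsArtinianRing k] [Module.Finite k Λ] {ι : (k ⧸ Ring.jacobson k) →ₗ[k] J}
    (hJ : IsInjectiveHull k ι) [IsSimpleModule Λᵐᵒᵖ X] {e : Λ} {x₀ : X} (hx : op e • x₀ = x₀) (hx0 : x₀ ≠ 0)
    {T : Type u} [AddCommGroup T] [Module Λ T] [IsSimpleModule Λ T] {v : T} (hv : IsTop e v) :
    IsDual (Λ := Λ) k J T X := by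
  have hmax := isMaximal_annihilator hX
  obtain ⟨j₀, hj₀, hmj₀, -⟩ := exists_generator_annihilated hJ (Module.annihilator k X)
  obtain ⟨φ, hφ⟩ : ∃ φ : X →ₗ[k] J, φ x₀ = j₀ := by
    have hc : ∀ c : k, c • x₀ = 0 → c • j₀ = 0 := fun c hc =>
      hmj₀ c (Module.mem_annihilator.2 (annihilated_of_simple hX hx0 hc))
    obtain ⟨h, hh⟩ := hJ.exists_extension (Submodule.span k {x₀}).subtype
      (Submodule.injective_subtype _) (LinearPMap.mkSpanSingleton' x₀ j₀ hc).toFun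
    refine ⟨h, (hh ⟨x₀, Submodule.mem_span_singleton_self x₀⟩).trans ?_⟩
    exact LinearPMap.mkSpanSingleton'_apply_self _ _ hc _
  -- Replacing `φ` by `e φ` gives a nonzero functional fixed by `e`; it generates the dual and
  -- identifies it with the top of `Λ e`.
  let φ₀ : X →ₗ[k] J := φ ∘ₗ rightMul hX e
  have hφ₀0 : φ₀ ≠ 0 := fun h => hj₀ (by
    have : φ (op e • x₀) = 0 := LinearMap.congr_fun h x₀
    rwa [hx, hφ] at this)
  have hφ₀e : ∀ x, φ₀ (op e • x) = φ₀ x := fun x => by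
    change φ (op e • op e • x) = φ (op e • x)
    rw [← mul_smul, ← op_mul, hv.idem]
  let Θ : Λ →+ (X →ₗ[k] J) :=
    { toFun := fun a => φ₀ ∘ₗ rightMul hX a
      map_zero' := LinearMap.ext fun x => by
        change φ₀ (op (0 : Λ) • x) = 0
        rw [MulOpposite.op_zero, zero_smul, map_zero]
      map_add' := fun a b => LinearMap.ext fun x => by
        change φ₀ (op (a + b) • x) = φ₀ (op a • x) + φ₀ (op b • x)
        rw [MulOpposite.op_add, add_smul, map_add] }
  have hΘ : ∀ a x, Θ a x = φ₀ (op a • x) := fun _ _ => rfl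
  have hΘs : Function.Surjective Θ := fun ψ => by
    obtain ⟨a, ha⟩ := exists_dual_eq hX hJ hφ₀0 ψ
    exact ⟨a, LinearMap.ext fun x => (ha x).symm⟩
  let K : Submodule Λ Λ :=
    { Θ.ker with
      smul_mem' := fun r a ha => by
        refine LinearMap.ext fun x => ?_
        have : Θ a (op r • x) = 0 := LinearMap.congr_fun (AddMonoidHom.mem_ker.1 ha) _
        rwa [hΘ, ← mul_smul, ← op_mul] at this }
  have hK : ∀ a, a ∈ K ↔ Θ a = 0 := fun a => Iff.rfl
  have hW : IsSimpleModule Λ (Λ ⧸ K) := by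
    rw [isSimpleModule_iff_toSpanSingleton_surjective]
    constructor
    · rw [Submodule.Quotient.nontrivial_iff]
      intro h
      have h1 : (1 : Λ) ∈ K := h ▸ Submodule.mem_top
      refine hφ₀0 (LinearMap.ext fun x => ?_)
      have := LinearMap.congr_fun ((hK 1).1 h1) x
      rwa [hΘ, op_one, one_smul] at this
    · intro q hq y
      obtain ⟨a, rfl⟩ := Submodule.Quotient.mk_surjective _ q
      obtain ⟨c, rfl⟩ := Submodule.Quotient.mk_surjective _ y
      rw [Ne, Submodule.Quotient.mk_eq_zero, hK] at hq
      obtain ⟨b, hb⟩ := exists_dual_eq hX hJ hq (Θ c)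
      refine ⟨b, ?_⟩
      rw [LinearMap.toSpanSingleton_apply, ← Submodule.Quotient.mk_smul, Submodule.Quotient.eq, hK,
        map_sub, sub_eq_zero]
      refine LinearMap.ext fun x => ?_
      rw [hb, hΘ, hΘ, ← mul_smul, ← op_mul, smul_eq_mul]
  obtain ⟨E⟩ := hv.nonempty_linearEquiv (S' := Λ ⧸ K) (w := Submodule.Quotient.mk 1) (by
      rw [← Submodule.Quotient.mk_smul, Submodule.Quotient.eq, hK, map_sub, sub_eq_zero]
      refine LinearMap.ext fun x => ?_
      rw [hΘ, hΘ, smul_eq_mul, mul_one, hφ₀e, op_one, one_smul]) (fun h => by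
      rw [Submodule.Quotient.mk_eq_zero, hK] at h
      refine hφ₀0 (LinearMap.ext fun x => ?_)
      have := LinearMap.congr_fun h x
      rwa [hΘ, op_one, one_smul] at this)
  let G : (Λ ⧸ K) ≃+ (X →ₗ[k] J) := QuotientAddGroup.quotientKerEquivOfSurjective Θ hΘs
  have hG : ∀ a, G (Submodule.Quotient.mk a) = Θ a := fun _ => rfl
  refine ⟨E.toAddEquiv.trans G, fun a n x => ?_⟩
  change G (E (a • n)) x = G (E n) (op a • x)
  obtain ⟨r, hr⟩ := Submodule.Quotient.mk_surjective _ (E n)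
  rw [map_smul, ← hr, ← Submodule.Quotient.mk_smul, hG, hG, hΘ, hΘ, smul_eq_mul, op_mul, mul_smul]

end Dual

/-! ### The Nakayama system of a Nakayama algebra. -/

section Existence

variable {Λ : Type u} [Ring Λ]

lemma SimpleMod.toClass_eq_iff {S T : SimpleMod Λ} :
    S.toClass = T.toClass ↔ Nonempty (S.1 ≃ₗ[Λ] T.1) :=
  Quotient.eq (r := simpleSetoid Λ)

lemma SimpleMod.exists_toClass_eq (x : SimpleClass Λ) : ∃ S : SimpleMod Λ, S.toClass = x :=
  Quotient.exists_rep x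

namespace NakayamaSystem

/-- The idempotent of a class of simple modules is the one of the projective cover. -/
def HasTops (D : NakayamaSystem Λ (SimpleClass Λ)) : Prop :=
  ∀ S : SimpleMod Λ, ∃ v : S.1, IsTop (D.e S.toClass) v

end NakayamaSystem

/-- A Nakayama ring whose indecomposable projective modules are long enough has a Nakayama
system. -/
lemma exists_nakayamaSystem [Nontrivial Λ] [IsArtinianRing Λ] (hΛ : IsNakayama Λ)
    (hps : ENat.card (SimpleClass Λ) < minProjectiveLength Λ) :
    ∃ D : NakayamaSystem Λ (SimpleClass Λ), D.HasTops ∧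
      ∀ x, ENat.card (SimpleClass Λ) < D.len x := by
  have hfin : Finite (SimpleClass Λ) := ENat.card_lt_top.1 (hps.trans_le le_top)
  choose S hS using fun x : SimpleClass Λ => SimpleMod.exists_toClass_eq x
  have hsimple : ∀ x, IsSimpleModule Λ (S x).1 := fun x => (S x).2
  choose e he hev hind using fun x => exists_idempotent_of_simple (R := Λ) (S x).1
  choose v hv hv0 using hev
  have htop : ∀ x, IsTop (e x) (v x) := fun x =>
    ⟨he x, hv x, hv0 x, fun a b ha hb =>
      (hΛ.1 _ inferInstance (projective_span (he x)) (hind x)).eq_mul_or ha hb⟩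
  have hlen : ∀ x, ENat.card (SimpleClass Λ) < Module.length Λ (Submodule.span Λ {e x}) :=
    fun x => hps.trans_le (sInf_le ⟨ModuleCat.of Λ (Submodule.span Λ {e x}),
      (inferInstance : Module.Finite Λ (Submodule.span Λ {e x})),
      projective_span (he x), hind x, rfl⟩)
  have hgen := generate_of_tops (e := e) fun T _ _ hT => by
    set T' : SimpleMod Λ := ⟨ModuleCat.of Λ T, hT⟩
    obtain ⟨E⟩ := SimpleMod.toClass_eq_iff.1 (hS T'.toClass)
    refine ⟨T'.toClass, E (v _), ?_⟩
    rw [← map_smul, hv]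
    exact fun h => hv0 _ (E.map_eq_zero_iff.1 h)
  obtain ⟨D, rfl⟩ := exists_system_of_tops hΛ.2 htop
    (fun x y E => by rw [← hS x, ← hS y]; exact SimpleMod.toClass_eq_iff.2 E) hgen (fun x => by
      -- Without radical elements `Λ e x` would be simple of length one, which is not larger than
      -- the number of simple classes.
      by_contra! H
      have hs : IsSimpleModule Λ (Submodule.span Λ {e x}) := by
        rw [isSimpleModule_iff_toSpanSingleton_surjective]
        refine ⟨(hind x).1, fun a ha => ?_⟩
        have hae : (a : Λ) * e x = a := mul_eq_of_mem_span (he x) a.2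
        have hav : (a : Λ) • v x ≠ 0 := fun h0 =>
          ha (Subtype.ext (H _ ((htop x).mem_jacobson hae h0) hae))
        obtain ⟨b, -, hb⟩ := (htop x).exists_mul_eq hae hav
        intro y
        refine ⟨y * b, Subtype.ext ?_⟩
        change (y : Λ) * b * a = y
        rw [mul_assoc, hb, mul_eq_of_mem_span (he x) y.2]
      have h1 := hlen x
      rw [Module.length_eq_one] at h1
      have : Nonempty (SimpleClass Λ) := ⟨x⟩
      exact absurd h1 (not_lt.2 ((ENat.one_le_card_iff_nonempty _).2 this)))
  refine ⟨D, fun T => ?_, fun x => (hlen x).trans_le (D.length_le x)⟩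
  obtain ⟨E⟩ := SimpleMod.toClass_eq_iff.1 (hS T.toClass)
  refine ⟨E (v _), (htop _).of_smul_eq ?_ fun h => hv0 _ (E.map_eq_zero_iff.1 h)⟩
  rw [← map_smul, hv]

end Existence

/-! ### The transpose of a simple module. -/

section Transposes

variable {k : Type v} [CommRing k] {Λ : Type u} [Ring Λ] [Algebra k Λ] {V : Type w}
  (D : NakayamaSystem Λ V) {P₀ P₁ : Type u} [AddCommGroup P₀] [Module Λ P₀] [AddCommGroup P₁]
  [Module Λ P₁] {f : P₁ →ₗ[Λ] P₀}

lemma smul_transpose_eq (c : k) (x : Transpose f) : c • x = op (algebraMap k Λ c) • x := by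
  obtain ⟨h, rfl⟩ := Submodule.Quotient.mk_surjective _ x
  rw [← Submodule.Quotient.mk_smul, ← Submodule.Quotient.mk_smul]
  congr 1
  refine LinearMap.ext fun q => ?_
  change c • h q = h q * algebraMap k Λ c
  rw [Algebra.smul_def, Algebra.commutes]

/-- Homomorphisms with values in the radical vanish in the transpose. -/
lemma mk_transpose_eq_zero {z : V} {q : P₁} (hq : Submodule.span Λ {q} = ⊤) {ψ : P₀ →ₗ[Λ] Λ}
    (hψ : ψ (f q) = D.α z) {h : P₁ →ₗ[Λ] Λ} {t : Λ} (ht : h q = D.α z * t) :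
    (Submodule.Quotient.mk h : Transpose f) = 0 := by
  rw [Submodule.Quotient.mk_eq_zero]
  refine ⟨op t • ψ, LinearMap.ext fun y => ?_⟩
  obtain ⟨r, rfl⟩ := Submodule.mem_span_singleton.1
    (hq ▸ Submodule.mem_top : y ∈ Submodule.span Λ {q})
  change ψ (f (r • q)) * t = h (r • q)
  rw [map_smul, map_smul, map_smul, hψ, ht, smul_eq_mul, smul_eq_mul, mul_assoc]

/-- If `w ≠ σ z`, the value of `h e_w` at the generator `q` is not invertible, hence divisible by
the arrow `α z`; such homomorphisms factor through `f`. -/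
lemma eq_of_smul_transpose_ne_zero {z w : V} {q : P₁} (hq : Submodule.span Λ {q} = ⊤)
    (hqe : D.e (D.σ z) • q = q) {ψ : P₀ →ₗ[Λ] Λ} (hψ : ψ (f q) = D.α z) {x : Transpose f}
    (hx : op (D.e w) • x ≠ 0) : w = D.σ z := by
  obtain ⟨h, rfl⟩ := Submodule.Quotient.mk_surjective _ x
  rcases D.unit_or_arrow w (D.σ z) (h q * D.e w)
    (by rw [← mul_assoc, ← smul_eq_mul (D.e (D.σ z)), ← map_smul, hqe])
    (by rw [mul_assoc, D.idem]) with ⟨h1, -⟩ | ⟨-, r, hr⟩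
  · exact h1
  · rw [Equiv.symm_apply_apply] at hr
    exact absurd (mk_transpose_eq_zero D hq hψ (h := op (D.e w) • h) hr) hx

/-- Evaluation at `q` presents the transpose as the right module `e R / α R`, with `e = e (σ z)` and
`α = α z`: the top of a uniserial right projective. -/
lemma isSimpleModule_transpose {z : V} {q : P₁} (hq : Submodule.span Λ {q} = ⊤)
    (hqe : D.e (D.σ z) • q = q) {ψ : P₀ →ₗ[Λ] Λ} (hψ : ψ (f q) = D.α z) {q₀ : P₀}
    (hq₀ : f q = D.α z • q₀) {h₀ : P₁ →ₗ[Λ] Λ} (hh₀ : h₀ q = D.e (D.σ z)) :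
    IsSimpleModule Λᵐᵒᵖ (Transpose f) ∧
      ∃ x : Transpose f, op (D.e (D.σ z)) • x = x ∧ x ≠ 0 := by
  have hx : (Submodule.Quotient.mk h₀ : Transpose f) ≠ 0 := by
    rw [Ne, Submodule.Quotient.mk_eq_zero]
    rintro ⟨g, hg⟩
    have h1 : D.e (D.σ z) * (D.α z * g q₀) = D.e (D.σ z) := by
      have : g (f q) = h₀ q := LinearMap.congr_fun hg q
      rw [← smul_eq_mul (D.α z), ← map_smul, ← hq₀, this, hh₀, D.idem]
    exact D.e_ne_zero _ (NakayamaSystem.eq_zero_of_mul_eq_self (D.nilpotent_arrow_mul z _) h1)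
  have hext : ∀ h h' : P₁ →ₗ[Λ] Λ, h q = h' q → h = h' := by
    intro h h' hhh
    refine LinearMap.ext fun y => ?_
    obtain ⟨r, rfl⟩ := Submodule.mem_span_singleton.1
      (hq ▸ Submodule.mem_top : y ∈ Submodule.span Λ {q})
    rw [map_smul, map_smul, hhh]
  refine ⟨?_, Submodule.Quotient.mk h₀, ?_, hx⟩
  · rw [isSimpleModule_iff_toSpanSingleton_surjective]
    refine ⟨⟨_, _, hx⟩, fun x hx0 y => ?_⟩
    obtain ⟨h, rfl⟩ := Submodule.Quotient.mk_surjective _ x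
    obtain ⟨h', rfl⟩ := Submodule.Quotient.mk_surjective _ y
    have hnot : ¬ ∃ t, h q = D.α z * t := fun ⟨t, ht⟩ => hx0 (mk_transpose_eq_zero D hq hψ ht)
    have hnot' : ¬ ∀ (w : V) (r : Λ), ∃ t, h q * r * D.e w = D.α z * t := fun H =>
      hnot (D.exists_eq_mul_of_homogeneous H)
    push Not at hnot'
    obtain ⟨w, r, hwr⟩ := hnot'
    have hhq : ∀ h : P₁ →ₗ[Λ] Λ, D.e (D.σ z) * h q = h q := fun h => by
      rw [← smul_eq_mul (D.e (D.σ z)), ← map_smul, hqe]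
    rcases D.unit_or_arrow w (D.σ z) (h q * r * D.e w)
      (by simp only [← mul_assoc, hhq]) (by rw [mul_assoc, D.idem]) with ⟨-, b, -, hb⟩ | ⟨-, t, ht⟩
    · refine ⟨op (r * D.e w * b * h' q), ?_⟩
      rw [LinearMap.toSpanSingleton_apply, ← Submodule.Quotient.mk_smul]
      congr 1
      refine hext _ _ ?_
      change h q * (r * D.e w * b * h' q) = h' q
      rw [← mul_assoc, ← mul_assoc, ← mul_assoc, hb, hhq]
    · rw [Equiv.symm_apply_apply] at ht
      exact absurd ht (hwr t)
  · rw [← Submodule.Quotient.mk_smul]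
    congr 1
    refine hext _ _ ?_
    change h₀ q * D.e (D.σ z) = h₀ q
    rw [hh₀, D.idem]

end Transposes

/-! ### Arrows of the resolution quiver. -/

namespace NakayamaSystem

section Generators

variable {R : Type u} [Ring R] {V : Type w} {D : NakayamaSystem R V}

lemma IsGenerator.map {M N : Type*} [AddCommGroup M] [Module R M] [AddCommGroup N] [Module R N]
    {x : V} {l : ℕ} {m : M} (h : D.IsGenerator x l m) (φ : M ≃ₗ[R] N) :
    D.IsGenerator x l (φ m) where
  e_smul := by rw [← map_smul, h.e_smul]
  span_eq_top := by
    rw [eq_top_iff]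
    intro y _
    obtain ⟨r, hr⟩ := Submodule.mem_span_singleton.1
      (h.span_eq_top ▸ Submodule.mem_top : φ.symm y ∈ Submodule.span R {m})
    refine Submodule.mem_span_singleton.2 ⟨r, ?_⟩
    rw [← map_smul, hr, φ.apply_symm_apply]
  path_smul_eq_zero_iff n := by
    rw [← map_smul, φ.map_eq_zero_iff, h.path_smul_eq_zero_iff]

variable (D)

lemma isGenerator_pathGen_zero (x : V) : D.IsGenerator x (D.len x) (D.pathGen 0 x) := by
  simpa using D.isGenerator_pathGen (Nat.zero_le (D.len x))

/-- The arrow at `x` as an element of the projective module `P(x)`. -/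
def arrowGen (x : V) : Submodule.span R {D.path 0 x} :=
  ⟨D.α x, D.mem_span_e_iff.2 (D.α_mul_e x)⟩

variable {D}

/-- The kernel of a projective cover of a simple module is generated by an arrow. -/
lemma IsGenerator.mem_ker_iff {M : Type u} [AddCommGroup M] [Module R M] {x : V} {m : M}
    (h : D.IsGenerator x 1 m) {r : Submodule.span R {D.path 0 x}} :
    D.fromProj x m r = 0 ↔ ∃ t : R, t • D.arrowGen x = r := by
  rw [(D.exact_fromProj h) r]
  constructor
  · rintro ⟨⟨s, hs⟩, rfl⟩
    obtain ⟨t, rfl⟩ := Submodule.mem_span_singleton.1 hs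
    exact ⟨t, Subtype.ext (congrArg (t • ·) (D.path_one x).symm)⟩
  · rintro ⟨t, rfl⟩
    exact ⟨⟨t • D.path 1 x, Submodule.mem_span_singleton.2 ⟨t, rfl⟩⟩,
      Subtype.ext (congrArg (t • ·) (D.path_one x))⟩

end Generators

section Quiver

variable {Λ : Type u} [Ring Λ] {D : NakayamaSystem Λ (SimpleClass Λ)}

lemma HasTops.exists_isGenerator (hD : D.HasTops) (S : SimpleMod Λ) :
    ∃ v : S.1, D.IsGenerator S.toClass 1 v := by
  obtain ⟨v, hv⟩ := hD S
  have := S.2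
  exact ⟨v, isGenerator_of_isTop hv⟩

lemma HasTops.isBlack_iff (hD : D.HasTops) {x : SimpleClass Λ} (hx : 1 < D.len x) :
    IsBlack x ↔ D.Black x := by
  constructor
  · rintro ⟨S, rfl, hS⟩
    obtain ⟨v, hv⟩ := hD.exists_isGenerator S
    exact (D.two_le_projectiveDimension_iff hv hx).1 hS
  · intro h
    obtain ⟨S, rfl⟩ := SimpleMod.exists_toClass_eq x
    obtain ⟨v, hv⟩ := hD.exists_isGenerator S
    exact ⟨S, rfl, (D.two_le_projectiveDimension_iff hv hx).2 h⟩

variable {k : Type v} [CommRing k] [Algebra k Λ] {J : Type v} [AddCommGroup J] [Module k J]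

/-- Any minimal presentation is compared with the standard one: a lift `q` of the arrow generates
`P₁` by minimality, so the transpose lives only at `σ z`. Nothing about `J` is needed in this
direction. -/
lemma HasTops.eq_of_isARTranslate (hD : D.HasTops) {M : Type u} [AddCommGroup M] [Module Λ M]
    {z : SimpleClass Λ} {m : M} (hm : D.IsGenerator z 1 m) {T : SimpleMod Λ}
    (hT : IsARTranslate (Λ := Λ) k J M T.1) : T.toClass = D.σ z := by
  obtain ⟨P₀, P₁, f, π, hπ, hf, hfc, E, hE⟩ := hT
  obtain ⟨φ, hφ⟩ := exists_linearEquiv_of_projectiveCovers hπ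
    (D.isProjectiveCover_fromProj hm one_pos)
  have hker : ∀ p : P₀, p ∈ LinearMap.range f ↔ ∃ t : Λ, t • D.arrowGen z = φ p := fun p => by
    rw [hf, LinearMap.mem_ker, ← hφ, ← hm.mem_ker_iff]
    rfl
  obtain ⟨p, hp⟩ := (hker (φ.symm (D.arrowGen z))).2
    ⟨1, by rw [one_smul, φ.apply_symm_apply]⟩
  set q : P₁ := D.e (D.σ z) • p with hq
  have hfq : f q = φ.symm (D.arrowGen z) := by
    rw [hq, map_smul, hp, ← map_smul]
    congr 1
    exact Subtype.ext (D.e_mul_α z)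
  have hqe : D.e (D.σ z) • q = q := by rw [hq, ← mul_smul, D.idem]
  have hspan : Submodule.span Λ {q} = ⊤ := by
    refine hfc.2.2 _ (eq_top_iff.2 fun y _ => ?_)
    obtain ⟨t, ht⟩ := (hker (f y)).1 ⟨y, rfl⟩
    refine Submodule.mem_sup.2 ⟨t • q, Submodule.mem_span_singleton.2 ⟨t, rfl⟩, y - t • q, ?_,
      by abel⟩
    rw [LinearMap.mem_ker]
    refine Subtype.ext ?_
    change f (y - t • q) = 0
    rw [map_sub, map_smul, hfq, ← map_smul, ht, φ.symm_apply_apply, sub_self]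
  obtain ⟨v, hv⟩ := hD T
  obtain ⟨x, hx⟩ : ∃ x, E v x ≠ 0 := by
    by_contra! h
    exact hv.ne_zero (E.map_eq_zero_iff.1 (LinearMap.ext h))
  rw [← hv.smul_eq, hE] at hx
  refine eq_of_smul_transpose_ne_zero D hspan hqe
    (ψ := (Submodule.subtype _).comp φ.toLinearMap) ?_ (x := x) fun h => hx (by rw [h, map_zero])
  change ((φ (f q) : Submodule.span Λ {D.path 0 z}) : Λ) = _
  rw [hfq, φ.apply_symm_apply]
  rfl

/-- The minimal presentation is `P(σ z) → P(z)`, right multiplication by the arrow. The bound on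
`len z` makes the arrow nonzero, which is needed for minimality. -/
lemma HasTops.isARTranslate [IsArtinianRing k] [Module.Finite k Λ]
    {ι : (k ⧸ Ring.jacobson k) →ₗ[k] J} (hJ : IsInjectiveHull k ι) (hD : D.HasTops) {M : Type u}
    [AddCommGroup M] [Module Λ M] {z : SimpleClass Λ} {m : M} (hm : D.IsGenerator z 1 m)
    (hz : 1 < D.len z) {T : SimpleMod Λ} (hT : T.toClass = D.σ z) :
    IsARTranslate (Λ := Λ) k J M T.1 := by
  let f := D.fromProj (D.σ z) (D.arrowGen z)
  have hfq : f (D.pathGen 0 (D.σ z)) = D.arrowGen z := Subtype.ext (D.e_mul_α z)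
  have hq : Submodule.span Λ {D.pathGen 0 (D.σ z)} = ⊤ :=
    (D.isGenerator_pathGen_zero (D.σ z)).span_eq_top
  have hqe : D.e (D.σ z) • D.pathGen 0 (D.σ z) = D.pathGen 0 (D.σ z) :=
    (D.isGenerator_pathGen_zero (D.σ z)).e_smul
  have hrange : LinearMap.range f = LinearMap.ker (D.fromProj z m) := by
    ext r
    rw [LinearMap.mem_ker, hm.mem_ker_iff]
    constructor
    · rintro ⟨a, rfl⟩
      exact ⟨a, rfl⟩
    · rintro ⟨t, rfl⟩
      exact ⟨t • D.pathGen 0 (D.σ z), by rw [map_smul, hfq]⟩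
  obtain ⟨v, hv⟩ := hD T
  have := T.2
  obtain ⟨hX, x, hx, hx0⟩ := isSimpleModule_transpose D hq hqe
    (f := f) (ψ := Submodule.subtype _) (congrArg Subtype.val hfq) (q₀ := D.pathGen 0 z)
    (hfq.trans (Subtype.ext (D.α_mul_e z).symm)) (h₀ := Submodule.subtype _) rfl
  refine ⟨ModuleCat.of Λ (Submodule.span Λ {D.path 0 z}),
    ModuleCat.of Λ (Submodule.span Λ {D.path 0 (D.σ z)}), f, D.fromProj z m,
    D.isProjectiveCover_fromProj hm one_pos, hrange, ?_,
    isDual_of_simple (smul_transpose_eq (k := k)) hJ hx hx0 (hT ▸ hv)⟩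
  refine ⟨inferInstance, f.surjective_rangeRestrict, fun N hN => ?_⟩
  refine (D.e_mem_or_of_add_eq hN).resolve_right fun hker => ?_
  have h0 : D.pathGen 0 (D.σ z) ∈ LinearMap.ker f.rangeRestrict := by rw [hker]; trivial
  rw [LinearMap.ker_rangeRestrict, LinearMap.mem_ker, hfq] at h0
  have h1 : D.path 1 z = 0 := by rw [path_one]; exact congrArg Subtype.val h0
  rw [path_eq_zero_iff] at h1
  omega

/-- The resolution quiver of a Nakayama algebra is the graph of `next`. -/
lemma HasTops.arrow_iff [IsArtinianRing k] [Module.Finite k Λ]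
    {ι : (k ⧸ Ring.jacobson k) →ₗ[k] J} (hJ : IsInjectiveHull k ι) (hD : D.HasTops)
    (hlen : ∀ x, 1 < D.len x) {x y : SimpleClass Λ} : Arrow k J x y ↔ y = D.next x := by
  obtain ⟨l, hl⟩ := Nat.exists_eq_add_of_le' (D.len_pos x)
  have hnext : D.next x = D.σ ((D.σ ^ l) x) := by
    rw [next, hl, pow_succ', Equiv.Perm.mul_apply]
  have hsoc : ∀ {P : Type u} [AddCommGroup P] [Module Λ P] {m : P}, D.IsGenerator x (D.len x) m →
      ∃ m' : socle Λ P, D.IsGenerator ((D.σ ^ l) x) 1 m' := fun h => by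
    rw [hl] at h
    exact ⟨_, h.isGenerator_of_span_eq h.socle_eq⟩
  rw [hnext]
  constructor
  · rintro ⟨S, T, P, π, rfl, rfl, hπ, hT⟩
    obtain ⟨v, hv⟩ := hD.exists_isGenerator S
    obtain ⟨φ, -⟩ := exists_linearEquiv_of_projectiveCovers
      (D.isProjectiveCover_fromProj hv one_pos) hπ
    obtain ⟨m, hm⟩ := hsoc ((D.isGenerator_pathGen_zero _).map φ)
    exact hD.eq_of_isARTranslate hm hT
  · intro hy
    obtain ⟨S, rfl⟩ := SimpleMod.exists_toClass_eq x
    obtain ⟨T, rfl⟩ := SimpleMod.exists_toClass_eq y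
    obtain ⟨v, hv⟩ := hD.exists_isGenerator S
    obtain ⟨m, hm⟩ := hsoc (D.isGenerator_pathGen_zero S.toClass)
    exact ⟨S, T, ModuleCat.of Λ (Submodule.span Λ {D.path 0 S.toClass}), D.fromProj _ v, rfl, rfl,
      D.isProjectiveCover_fromProj hv one_pos, hD.isARTranslate hJ hm (hlen _) hy⟩

end Quiver

end NakayamaSystem

/-! ### Cycles and periodic points of a self-map. -/

section Dynamics

variable {V : Type w} {f : V → V}

lemma exists_cycle_of_mem_periodicPts {x : V} (hx : x ∈ Function.periodicPts f) :
    ∃ (n : ℕ) (c : ZMod (n + 1) → V), Function.Injective c ∧ (∀ i, c (i + 1) = f (c i)) ∧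
      c 0 = x := by
  obtain ⟨n, hn⟩ := Nat.exists_eq_add_of_le'
    (Function.minimalPeriod_pos_of_mem_periodicPts hx)
  refine ⟨n, fun i => f^[i.val] x, fun i j hij => ?_, fun i => ?_, by simp⟩
  · refine ZMod.val_injective _ (Function.iterate_injOn_Iio_minimalPeriod
      (f := f) (x := x) ?_ ?_ hij)
    · rw [Set.mem_Iio, hn]; exact ZMod.val_lt i
    · rw [Set.mem_Iio, hn]; exact ZMod.val_lt j
  · change f^[(i + 1).val] x = f (f^[i.val] x)
    have h := Function.iterate_mod_minimalPeriod_eq (f := f) (x := x) (n := i.val + 1)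
    rw [hn] at h
    rw [← Function.iterate_succ_apply' f, ZMod.val_add, ZMod.val_one_eq_one_mod, Nat.add_mod_mod]
    exact h

lemma mem_periodicPts_of_cycle {n : ℕ} {c : ZMod (n + 1) → V} (hc : ∀ i, c (i + 1) = f (c i))
    (i : ZMod (n + 1)) : c i ∈ Function.periodicPts f := by
  have h : ∀ m : ℕ, f^[m] (c i) = c (i + m) := by
    intro m
    induction m with
    | zero => simp
    | succ m ih => rw [Function.iterate_succ_apply', ih, ← hc, Nat.cast_succ, add_assoc]
  refine Function.mk_mem_periodicPts n.succ_pos ?_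
  change f^[n + 1] (c i) = c i
  rw [h, ZMod.natCast_self, add_zero]

lemma iterate_mem_periodicPts {x : V} (hx : x ∈ Function.periodicPts f) (n : ℕ) :
    f^[n] x ∈ Function.periodicPts f := by
  obtain ⟨m, hm, h⟩ := Function.mem_periodicPts.1 hx
  exact Function.mk_mem_periodicPts hm (h.apply_iterate n)

lemma iterate_mem_periodicPts_of_le {x : V} {m n : ℕ} (h : f^[m] x ∈ Function.periodicPts f)
    (hmn : m ≤ n) : f^[n] x ∈ Function.periodicPts f := by
  obtain ⟨j, rfl⟩ := Nat.exists_eq_add_of_le' hmn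
  rw [Function.iterate_add_apply]
  exact iterate_mem_periodicPts h j

lemma exists_forall_iterate_mem_periodicPts [Finite V] (f : V → V) :
    ∃ m, ∀ x, f^[m] x ∈ Function.periodicPts f := by
  obtain ⟨i, j, hij, h⟩ := Finite.exists_ne_map_eq_of_infinite fun n : ℕ => f^[n]
  wlog hlt : i < j generalizing i j
  · exact this j i hij.symm h.symm (by omega)
  refine ⟨i, fun x => Function.mk_mem_periodicPts (Nat.sub_pos_of_lt hlt) ?_⟩
  change f^[j - i] (f^[i] x) = f^[i] x
  rw [← Function.iterate_add_apply, Nat.sub_add_cancel hlt.le]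
  exact (congrFun h x).symm

end Dynamics

section Dimension

lemma eq_natCast_of_forall_le_natCast_iff {a : WithBot ℕ∞} {m : ℕ} (ha : a ≠ ⊥)
    (h : ∀ n : ℕ, a ≤ n ↔ m ≤ n) : a = m := by
  refine le_antisymm ((h m).2 le_rfl) ?_
  induction a with
  | bot => exact absurd rfl ha
  | coe a =>
    induction a with
    | top => exact le_top
    | coe a =>
      have := (h a).1 le_rfl
      exact_mod_cast this

lemma injectiveDimension_lt_top_iff {R : Type u} [Ring R] (X : ModuleCat.{u} R) :
    injectiveDimension X < ⊤ ↔ ∃ n : ℕ, injectiveDimension X ≤ n := by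
  simp_rw [lt_top_iff_ne_top, injectiveDimension_ne_top_iff, injectiveDimension_le_iff]

lemma nonempty_simpleClass (R : Type u) [Ring R] [Nontrivial R] : Nonempty (SimpleClass R) := by
  obtain ⟨m, hm⟩ := Ideal.exists_maximal R
  have : IsSimpleModule R (R ⧸ m) := isSimpleModule_iff_isCoatom.2 (Ideal.isMaximal_def.1 hm)
  exact ⟨SimpleMod.toClass ⟨ModuleCat.of R (R ⧸ m), this⟩⟩

/-- The regular right module, seen over the opposite ring. -/
def opRegularEquiv (R : Type u) [Ring R] : R ≃ₗ[Rᵐᵒᵖ] Rᵐᵒᵖ where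
  toFun := op
  invFun := unop
  map_add' _ _ := rfl
  map_smul' _ _ := rfl
  left_inv _ := rfl
  right_inv _ := rfl

end Dimension

/-! ### Self-injective dimensions and distances to black cycles. -/

namespace NakayamaSystem

section InjectiveDimension

variable {R : Type u} [Ring R] {V : Type w} {D : NakayamaSystem R V}

/-- An orbit of `σ` has at most `s` elements. This is where `p > s` is used in full. -/
lemma exists_period [Finite V] (hlen : ∀ x, ENat.card V < D.len x) (x : V) :
    ∃ t, 0 < t ∧ (D.σ ^ t) x = x ∧ ∀ y, t < D.len y := by
  have := Fintype.ofFinite V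
  have hx : x ∈ Function.periodicPts D.σ := D.σ.injective.mem_periodicPts x
  refine ⟨Function.minimalPeriod D.σ x, Function.minimalPeriod_pos_of_mem_periodicPts hx, ?_,
    fun y => Function.minimalPeriod_le_card.trans_lt ?_⟩
  · rw [Equiv.Perm.coe_pow]
    exact Function.iterate_minimalPeriod
  · have := hlen y
    rw [ENat.card_eq_coe_fintype_card] at this
    exact_mod_cast this

lemma opp_exists_period (hp : ∀ x, ∃ t, 0 < t ∧ (D.σ ^ t) x = x ∧ ∀ y, t < D.len y) (x : V) :
    ∃ t, 0 < t ∧ (D.opp.σ ^ t) x = x ∧ ∀ y, t < D.opp.len y := by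
  obtain ⟨t, ht, hx, hlt⟩ := hp x
  refine ⟨t, ht, ?_, fun y => ?_⟩
  · change (D.σ⁻¹ ^ t) x = x
    rw [inv_pow, Equiv.Perm.inv_eq_iff_eq, hx]
  · obtain ⟨z, rfl⟩ := (D.σ ^ t).surjective y
    rw [← not_le, opp_len_le_iff, not_le]
    exact hlt z

lemma leftInjDim_le_iff [IsNoetherianRing R]
    (hp : ∀ x, ∃ t, 0 < t ∧ (D.σ ^ t) x = x ∧ ∀ y, t < D.len y) (n : ℕ) :
    leftInjDim R ≤ n ↔ ∀ x, D.Black (D.next^[n / 2] x) := by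
  rw [leftInjDim, injectiveDimension_le_iff, D.hasInjectiveDimensionLE_iff hp]

/-- The left criterion for the opposite system is rewritten in terms of `D` by the symmetry
`opp_black_iff`, so both dimensions obey the same condition. -/
lemma rightInjDim_le_iff [Finite V] [IsNoetherianRing Rᵐᵒᵖ]
    (hp : ∀ x, ∃ t, 0 < t ∧ (D.σ ^ t) x = x ∧ ∀ y, t < D.len y) (n : ℕ) :
    rightInjDim R ≤ n ↔ ∀ x, D.Black (D.next^[n / 2] x) := by
  rw [rightInjDim, injectiveDimension_le_iff,
    ModuleCat.hasInjectiveDimensionLE_iff_of_linearEquiv (M := ModuleCat.of Rᵐᵒᵖ R)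
      (N := ModuleCat.of Rᵐᵒᵖ Rᵐᵒᵖ) (opRegularEquiv R),
    D.opp.hasInjectiveDimensionLE_iff (opp_exists_period hp), opp_black_iff]

end InjectiveDimension

section Quiver

variable {k : Type v} [CommRing k] {Λ : Type u} [Ring Λ] [Algebra k Λ]
  {J : Type v} [AddCommGroup J] [Module k J] {D : NakayamaSystem Λ (SimpleClass Λ)}

lemma isCycle_iff (harrow : ∀ x y : SimpleClass Λ, Arrow k J x y ↔ y = D.next x) {n : ℕ}
    {c : ZMod (n + 1) → SimpleClass Λ} :
    IsCycle k J n c ↔ Function.Injective c ∧ ∀ i, c (i + 1) = D.next (c i) := by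
  simp_rw [IsCycle, harrow]

lemma allCyclesBlack_iff (harrow : ∀ x y : SimpleClass Λ, Arrow k J x y ↔ y = D.next x)
    (hblack : ∀ x, IsBlack x ↔ D.Black x) :
    AllCyclesBlack k J Λ ↔ ∀ x ∈ Function.periodicPts D.next, D.Black x := by
  constructor
  · intro h x hx
    obtain ⟨n, c, hc, hc', rfl⟩ := exists_cycle_of_mem_periodicPts hx
    exact (hblack _).1 (h n c ((isCycle_iff harrow).2 ⟨hc, hc'⟩) 0)
  · exact fun h n c hc i => (hblack _).2
      (h _ (mem_periodicPts_of_cycle ((isCycle_iff harrow).1 hc).2 i))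

lemma isCyclicallyBlack_iff (harrow : ∀ x y : SimpleClass Λ, Arrow k J x y ↔ y = D.next x)
    (hper : ∀ x ∈ Function.periodicPts D.next, IsBlack x) {x : SimpleClass Λ} :
    IsCyclicallyBlack k J x ↔ x ∈ Function.periodicPts D.next := by
  constructor
  · rintro ⟨n, c, hc, -, i, rfl⟩
    exact mem_periodicPts_of_cycle ((isCycle_iff harrow).1 hc).2 i
  · intro hx
    obtain ⟨n, c, hc, hc', rfl⟩ := exists_cycle_of_mem_periodicPts hx
    exact ⟨n, c, (isCycle_iff harrow).2 ⟨hc, hc'⟩,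
      fun i => hper _ (mem_periodicPts_of_cycle hc' i), 0, rfl⟩

/-- Exactly one arrow leaves each vertex, so a path is an initial piece of an orbit of `next`. -/
lemma hasPathToBlackCycle_iff (harrow : ∀ x y : SimpleClass Λ, Arrow k J x y ↔ y = D.next x)
    (hper : ∀ x ∈ Function.periodicPts D.next, IsBlack x) {x : SimpleClass Λ} {n : ℕ} :
    HasPathToBlackCycle k J x n ↔ D.next^[n] x ∈ Function.periodicPts D.next := by
  simp_rw [HasPathToBlackCycle, isCyclicallyBlack_iff harrow hper, harrow]
  constructor
  · rintro ⟨c, rfl, hc, hn⟩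
    have : ∀ i ≤ n, c i = D.next^[i] (c 0) := by
      intro i hi
      induction i with
      | zero => rfl
      | succ i ih => rw [hc i hi, ih (by omega), Function.iterate_succ_apply']
    rwa [this n le_rfl] at hn
  · exact fun h => ⟨fun i => D.next^[i] x, rfl, fun i _ => Function.iterate_succ_apply' _ _ _, h⟩

lemma distToBlack_le_iff (harrow : ∀ x y : SimpleClass Λ, Arrow k J x y ↔ y = D.next x)
    (hper : ∀ x ∈ Function.periodicPts D.next, IsBlack x) {x : SimpleClass Λ} {m : ℕ} :
    distToBlack k J x ≤ m ↔ D.next^[m] x ∈ Function.periodicPts D.next := by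
  rw [← ENat.lt_add_one_iff (ENat.natCast_ne_top m), distToBlack, sInf_lt_iff]
  constructor
  · rintro ⟨_, ⟨n, rfl, hn⟩, hlt⟩
    rw [ENat.lt_add_one_iff (ENat.natCast_ne_top m)] at hlt
    exact iterate_mem_periodicPts_of_le ((hasPathToBlackCycle_iff harrow hper).1 hn)
      (by exact_mod_cast hlt)
  · exact fun h => ⟨m, ⟨m, rfl, (hasPathToBlackCycle_iff harrow hper).2 h⟩,
      (ENat.lt_add_one_iff (ENat.natCast_ne_top m)).2 le_rfl⟩

lemma isGreatest_distToBlack [Nonempty (SimpleClass Λ)]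
    (harrow : ∀ x y : SimpleClass Λ, Arrow k J x y ↔ y = D.next x)
    (hper : ∀ x ∈ Function.periodicPts D.next, IsBlack x) {d : ℕ}
    (hd : ∀ m, (∀ x, D.next^[m] x ∈ Function.periodicPts D.next) ↔ d ≤ m) :
    IsGreatest (Set.range (distToBlack (Λ := Λ) k J)) (d : ℕ∞) := by
  have hle : ∀ x : SimpleClass Λ, distToBlack k J x ≤ d := fun x =>
    (distToBlack_le_iff harrow hper).2 ((hd d).2 le_rfl x)
  refine ⟨?_, Set.forall_mem_range.2 hle⟩
  obtain _ | e := d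
  · exact ⟨Classical.arbitrary _, le_antisymm (hle _) (by simp)⟩
  · have he : ¬ ∀ x, D.next^[e] x ∈ Function.periodicPts D.next := by
      rw [hd]
      omega
    push Not at he
    obtain ⟨x, hx⟩ := he
    rw [← distToBlack_le_iff harrow hper, not_le] at hx
    refine ⟨x, le_antisymm (hle x) ?_⟩
    rw [Nat.cast_succ]
    exact Order.add_one_le_of_lt hx

end Quiver

end NakayamaSystem

end ArtinAlg

theorem proposition6
    {k : Type v} [CommRing k] [IsArtinianRing k]
    {Λ : Type u} [Ring Λ] [Nontrivial Λ] [Algebra k Λ] [Module.Finite k Λ]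
    {J : Type v} [AddCommGroup J] [Module k J]
    (ι : (k ⧸ Ring.jacobson k) →ₗ[k] J) (hJ : ArtinAlg.IsInjectiveHull k ι)
    (hΛ : ArtinAlg.IsNakayama Λ)
    (hps : ENat.card (ArtinAlg.SimpleClass Λ) < ArtinAlg.minProjectiveLength Λ) :
    (ArtinAlg.IsGorenstein Λ ↔ ArtinAlg.AllCyclesBlack k J Λ) ∧
    (ArtinAlg.IsGorenstein Λ →
      ∃ d : ℕ,
        IsGreatest (Set.range (ArtinAlg.distToBlack (Λ := Λ) k J)) (d : ℕ∞) ∧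
        ArtinAlg.IsGorensteinDimension Λ (2 * d)) := by
  open ArtinAlg NakayamaSystem in
  classical
  have hart : IsArtinianRing Λ := IsArtinianRing.of_finite k Λ
  have hfinop : Module.Finite k Λᵐᵒᵖ := Module.Finite.equiv (opLinearEquiv k : Λ ≃ₗ[k] Λᵐᵒᵖ)
  have hnoeth : IsNoetherianRing Λᵐᵒᵖ := IsNoetherianRing.of_finite k Λᵐᵒᵖ
  have hfin : Finite (SimpleClass Λ) := ENat.card_lt_top.1 (hps.trans_le le_top)
  have hne := nonempty_simpleClass Λ
  obtain ⟨D, hD, hlen⟩ := exists_nakayamaSystem hΛ hps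
  have hlen1 : ∀ x, 1 < D.len x := fun x => by
    have := ((ENat.one_le_card_iff_nonempty _).2 hne).trans_lt (hlen x)
    exact_mod_cast this
  have hblack : ∀ x : SimpleClass Λ, IsBlack x ↔ D.Black x := fun x => hD.isBlack_iff (hlen1 x)
  have harrow : ∀ x y : SimpleClass Λ, Arrow k J x y ↔ y = D.next x := fun x y =>
    hD.arrow_iff hJ hlen1
  have hcycles := allCyclesBlack_iff harrow hblack
  have hp := exists_period hlen
  have hl := leftInjDim_le_iff hp
  have hr := rightInjDim_le_iff hp
  have hGor : IsGorenstein Λ ↔ AllCyclesBlack k J Λ := by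
    rw [hcycles]
    constructor
    · rintro ⟨h, -⟩
      obtain ⟨n, hn⟩ := (injectiveDimension_lt_top_iff _).1 h
      exact ((D.forall_black_iff _).1 ((hl n).1 hn)).1
    · intro h
      obtain ⟨m, hm⟩ := exists_forall_iterate_mem_periodicPts D.next
      have hm' := (D.forall_black_iff m).2 ⟨h, hm⟩
      exact ⟨(injectiveDimension_lt_top_iff _).2 ⟨2 * m, (hl _).2 (by simpa using hm')⟩,
        (injectiveDimension_lt_top_iff _).2 ⟨2 * m, (hr _).2 (by simpa using hm')⟩⟩
  refine ⟨hGor, fun h => ?_⟩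
  have hper := hcycles.1 (hGor.1 h)
  have hex := exists_forall_iterate_mem_periodicPts D.next
  have hd : ∀ m, (∀ x, D.next^[m] x ∈ Function.periodicPts D.next) ↔ Nat.find hex ≤ m := fun m =>
    ⟨fun hm => Nat.find_min' hex hm,
      fun hm x => iterate_mem_periodicPts_of_le (Nat.find_spec hex x) hm⟩
  -- With the periodic vertices black, only `d ≤ n / 2` remains, which is `2 * d ≤ n`.
  have hdim : ∀ n : ℕ, (∀ x, D.Black (D.next^[n / 2] x)) ↔ 2 * Nat.find hex ≤ n := fun n => by
    rw [D.forall_black_iff, hd, and_iff_right hper]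
    omega
  refine ⟨Nat.find hex, isGreatest_distToBlack harrow (fun x hx => (hblack x).2 (hper x hx)) hd,
    eq_natCast_of_forall_le_natCast_iff ?_ fun n => (hl n).trans (hdim n),
    eq_natCast_of_forall_le_natCast_iff ?_ fun n => (hr n).trans (hdim n)⟩
  · rw [leftInjDim, Ne, injectiveDimension_eq_bot_iff, ModuleCat.isZero_iff_subsingleton]
    exact not_subsingleton Λ
  · rw [rightInjDim, Ne, injectiveDimension_eq_bot_iff, ModuleCat.isZero_iff_subsingleton]
    exact not_subsingleton Λ
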